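/- Let $p\ge 2$, let $S^{p-1}\subset\mathbb R^p$ be the unit sphere, of dimension $d=p-1$, and let $X$ be uniformly distributed on $S^{p-1}$. For $x\in S^{p-1}$ and $\epsilon>0$ let $\chi$ be the indicator function of the Euclidean ball of radius $\epsilon$ about $x$, and put $$C_x=\mathbb E\big[(X-x)(X-x)^\top\chi(X)\big],\qquad \mathbf T_x=\mathcal I_{\epsilon^{d+\rho}}(C_x)\,\mathbb E\big[(X-x)\chi(X)\big],$$ where, for $c>0$ and a symmetric positive semidefinite matrix $C$ with orthonormal eigenvectors $u_i$ and eigenvalues $\lambda_i$, $\mathcal I_c(C)=\sum_{\lambda_i\neq0}(\lambda_i+c)^{-1}u_iu_i^\top$. The locally linear embedding operator with regularization order $\rho$ is $$Qf(x)=\frac{\mathbb E\big[f(X)\,(1-\mathbf T_x^\top(X-x))\,\chi(X)\big]}{\mathbb E\big[(1-\mathbf T_x^\top(X-x))\,\chi(X)\big]}.$$ Take $\rho=8$. Then for every $x\in S^{p-1}$ the denominator is nonzero for all sufficiently small $\epsilon>0$, and for every $f\in C^6(S^{p-1})$, as $\epsilon\to0^+$ (with $x$ and $f$ fixed), the $\epsilon^2$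 term cancels and $$Qf(x)-f(x)=\Big(-\frac{1}{8(p+3)(p+5)}\sum_{i=1}^{p-1}\partial_i^4f(x)-\frac{1}{8(p+3)(p+5)}\sum_{i\ne j}\partial_i^2\partial_j^2f(x)-\frac{p+1}{24(p+3)(p+5)}\sum_{i=1}^{p-1}\partial_i^2f(x)\Big)\epsilon^4+O(\epsilon^6),$$ where $\partial_1,\dots,\partial_{p-1}$ are the partial derivatives at $x$ in the normal coordinates given by an arbitrary orthonormal basis of $T_xS^{p-1}$, and the second sum runs over ordered pairs. In particular, on $S^1$, with derivatives taken with respect to arc length, $$Qf(x)-f(x)=-\frac1{280}\big(f''''(x)+f''(x)\big)\epsilon^4+O(\epsilon^6).$$ If $f$ is only of class $C^5$, both expansions hold with the remainder $O(\epsilon^6)$ replaced by $O(\epsilon^5)$. -/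

import Mathlib

open MeasureTheory Set Filter Topology Asymptotics
open scoped Manifold ContDiff EuclideanSpace

noncomputable section

namespace LLE

/-! ### The population LLE operator of a manifold embedded in Euclidean space

`M` is the manifold, `ι : M → ℝᵖ` the embedding and `ν = P dV` the sampling law on `M`, so that
`𝔼[h(X)]` is the integral of `h ∘ ι` with respect to `ν`. -/

section General

variable {M : Type*} [MeasurableSpace M] {p : ℕ}

/-- The points of `M` that lie in the Euclidean ball of radius `ε` around `ι x`. -/
def nbhd (ι : M → EuclideanSpace ℝ (Fin p)) (ε : ℝ) (x : M) : Set M :=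
  {y | ι y ∈ Metric.ball (ι x) ε}

/-- The local covariance matrix `C_x = 𝔼[(X - ι x)(X - ι x)ᵀ χ_{B_ε(ι x)}(X)]`. -/
def localCov (ι : M → EuclideanSpace ℝ (Fin p)) (ν : Measure M) (ε : ℝ) (x : M) :
    Matrix (Fin p) (Fin p) ℝ :=
  Matrix.of fun i j => ∫ y in nbhd ι ε x, (ι y i - ι x i) * (ι y j - ι x j) ∂ν

theorem localCov_isHermitian (ι : M → EuclideanSpace ℝ (Fin p)) (ν : Measure M) (ε : ℝ) (x : M) :
    (localCov ι ν ε x).IsHermitian := by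
  ext i j
  simp [localCov, Matrix.conjTranspose_apply, mul_comm]

/-- The vector `𝔼[(X - ι x) χ_{B_ε(ι x)}(X)]`. -/
def localMean (ι : M → EuclideanSpace ℝ (Fin p)) (ν : Measure M) (ε : ℝ) (x : M) :
    EuclideanSpace ℝ (Fin p) :=
  ∫ y in nbhd ι ε x, (ι y - ι x) ∂ν

/-- The regularized pseudo-inverse `𝓘_c(C) = ∑ (λᵢ + c)⁻¹ uᵢ uᵢᵀ` of a symmetric matrix `C`, the
sum being over an orthonormal eigenbasis `uᵢ` restricted to the nonzero eigenvalues `λᵢ`. -/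
def regPinv (c : ℝ) (C : Matrix (Fin p) (Fin p) ℝ) (hC : C.IsHermitian) :
    Matrix (Fin p) (Fin p) ℝ :=
  (hC.eigenvectorUnitary : Matrix (Fin p) (Fin p) ℝ) *
    Matrix.diagonal (fun i => if hC.eigenvalues i = 0 then 0 else (hC.eigenvalues i + c)⁻¹) *
    (hC.eigenvectorUnitary : Matrix (Fin p) (Fin p) ℝ).transpose

/-- The vector `T_{ι x} = 𝓘_{ε^(d+ρ)}(C_x) 𝔼[(X - ι x) χ_{B_ε(ι x)}(X)]`, where `d` is the
dimension of the manifold and `ρ` the regularization order. -/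
def T (d : ℕ) (ρ : ℝ) (ι : M → EuclideanSpace ℝ (Fin p)) (ν : Measure M) (ε : ℝ) (x : M) :
    EuclideanSpace ℝ (Fin p) :=
  WithLp.toLp 2 ((regPinv (ε ^ ((d : ℝ) + ρ)) (localCov ι ν ε x)
    (localCov_isHermitian ι ν ε x)).mulVec (localMean ι ν ε x).ofLp)

/-- `A f (x) = 𝔼[f(X) (1 - T_{ι x}ᵀ (X - ι x)) χ_{B_ε(ι x)}(X)]`. -/
def A (d : ℕ) (ρ : ℝ) (ι : M → EuclideanSpace ℝ (Fin p)) (ν : Measure M) (ε : ℝ)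
    (f : M → ℝ) (x : M) : ℝ :=
  ∫ y in nbhd ι ε x, f y * (1 - inner ℝ (T d ρ ι ν ε x) (ι y - ι x)) ∂ν

/-- The LLE operator `Q f (x) = A f (x) / A 1 (x)`. -/
def Q (d : ℕ) (ρ : ℝ) (ι : M → EuclideanSpace ℝ (Fin p)) (ν : Measure M) (ε : ℝ)
    (f : M → ℝ) (x : M) : ℝ :=
  A d ρ ι ν ε f x / A d ρ ι ν ε (fun _ => 1) x

end General

/-! ### The unit sphere -/

/-- The unit sphere `S^d` in `ℝ^(d+1)`. -/
abbrev Sph (d : ℕ) : Type := Metric.sphere (0 : EuclideanSpace ℝ (Fin (d + 1))) 1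

/-- The inclusion `S^d → ℝ^(d+1)`. -/
def incl (d : ℕ) : Sph d → EuclideanSpace ℝ (Fin (d + 1)) := Subtype.val

/-- The uniform probability measure on `S^d`: surface measure divided by the total area. -/
def uniformSph (d : ℕ) : Measure (Sph d) :=
  ((volume : Measure (EuclideanSpace ℝ (Fin (d + 1)))).toSphere univ)⁻¹ •
    (volume : Measure (EuclideanSpace ℝ (Fin (d + 1)))).toSphere

/-- The tangent space of `S^d` at `x`, as the hyperplane `x^⊥` of `ℝ^(d+1)`. -/
abbrev Tan {d : ℕ} (x : Sph d) : Submodule ℝ (EuclideanSpace ℝ (Fin (d + 1))) :=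
  (Submodule.span ℝ {(x : EuclideanSpace ℝ (Fin (d + 1)))})ᗮ

theorem norm_exp_aux {d : ℕ} (x : Sph d) (v : Tan x) :
    ‖Real.cos ‖v‖ • (x : EuclideanSpace ℝ (Fin (d + 1))) +
      Real.sinc ‖v‖ • (v : EuclideanSpace ℝ (Fin (d + 1)))‖ = 1 := by
  have hx : ‖(x : EuclideanSpace ℝ (Fin (d + 1)))‖ = 1 := norm_eq_of_mem_sphere x
  have hxv : inner ℝ (x : EuclideanSpace ℝ (Fin (d + 1))) (v : EuclideanSpace ℝ (Fin (d + 1)))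
      = 0 := Submodule.mem_orthogonal_singleton_iff_inner_right.mp v.2
  have hs : Real.sinc ‖v‖ * ‖v‖ = Real.sin ‖v‖ := by
    by_cases h : ‖v‖ = 0
    · simp [h]
    · rw [Real.sinc_of_ne_zero h]; field_simp
  have h2 : ‖Real.cos ‖v‖ • (x : EuclideanSpace ℝ (Fin (d + 1))) +
      Real.sinc ‖v‖ • (v : EuclideanSpace ℝ (Fin (d + 1)))‖ ^ 2 = 1 := by
    rw [norm_add_sq_real, inner_smul_left, inner_smul_right, hxv, norm_smul, norm_smul, hx,
      ← Submodule.coe_norm, Real.norm_eq_abs, Real.norm_eq_abs, mul_pow, mul_pow, sq_abs, sq_abs,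
      ← mul_pow (Real.sinc ‖v‖), hs]
    simp
  have h0 := norm_nonneg (Real.cos ‖v‖ • (x : EuclideanSpace ℝ (Fin (d + 1))) +
      Real.sinc ‖v‖ • (v : EuclideanSpace ℝ (Fin (d + 1))))
  nlinarith

/-- The exponential map of `S^d` at `x`: `v ↦ cos |v| x + (sin |v| / |v|) v`. -/
def expMap {d : ℕ} (x : Sph d) (v : Tan x) : Sph d :=
  ⟨Real.cos ‖v‖ • (x : EuclideanSpace ℝ (Fin (d + 1))) +
      Real.sinc ‖v‖ • (v : EuclideanSpace ℝ (Fin (d + 1))), by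
    simpa using norm_exp_aux x v⟩

/-- The function `f` read in the normal coordinates at `x` given by an orthonormal basis `b` of the
tangent space. -/
def inNormalCoord {d : ℕ} (x : Sph d) (b : OrthonormalBasis (Fin d) ℝ (Tan x)) (f : Sph d → ℝ)
    (v : EuclideanSpace ℝ (Fin d)) : ℝ :=
  f (expMap x (∑ i, v i • b i))

/-- The second partial derivative `∂ᵢ² f (x)` in normal coordinates at `x`. -/
def d2 {d : ℕ} (x : Sph d) (b : OrthonormalBasis (Fin d) ℝ (Tan x)) (f : Sph d → ℝ)
    (i : Fin d) : ℝ :=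
  iteratedFDeriv ℝ 2 (inNormalCoord x b f) 0
    ![EuclideanSpace.single i 1, EuclideanSpace.single i 1]

/-- The fourth partial derivative `∂ᵢ² ∂ⱼ² f (x)` in normal coordinates at `x`; for `j = i` this is
`∂ᵢ⁴ f (x)`. -/
def d22 {d : ℕ} (x : Sph d) (b : OrthonormalBasis (Fin d) ℝ (Tan x)) (f : Sph d → ℝ)
    (i j : Fin d) : ℝ :=
  iteratedFDeriv ℝ 4 (inNormalCoord x b f) 0
    ![EuclideanSpace.single i 1, EuclideanSpace.single i 1,
      EuclideanSpace.single j 1, EuclideanSpace.single j 1]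

/-- The fourth-order differential operator of the expansion on `S^(p-1)`, `p = d + 1`. -/
def fourthOrderOp {d : ℕ} (x : Sph d) (b : OrthonormalBasis (Fin d) ℝ (Tan x))
    (f : Sph d → ℝ) : ℝ :=
  let p : ℝ := (d : ℝ) + 1;
  -(1 / (8 * (p + 3) * (p + 5))) * ∑ i, d22 x b f i i
    - 1 / (8 * (p + 3) * (p + 5)) * ∑ i, ∑ j ∈ Finset.univ.filter (fun j => j ≠ i), d22 x b f i j
    - (p + 1) / (24 * (p + 3) * (p + 5)) * ∑ i, d2 x b f i

/-- The point `(cos t, sin t)` of the unit circle `S¹` in `ℝ²`. -/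
def circlePt (t : ℝ) : Sph 1 :=
  ⟨!₂[Real.cos t, Real.sin t], by
    simp [EuclideanSpace.norm_eq, Fin.sum_univ_two]⟩

end LLE

end

/-! Write `s = 1 - ⟨x, X⟩` for the height below `x` and `M_k = 𝔼[s ^ k χ]` (`heightMoment`). The
reflection through the line of `x` preserves the cap, so the local mean is `-M_1 x` and `C_x x = M_2
x`. Hence `T_x` is a multiple of `x`, the tangential eigenvalues of `C_x` never enter, and the
weight of the operator is `1 - κ s` with `κ = M_1 / (M_2 + ε^(d+8))` (`T_sph`, `A_sph`). Therefore
`Q f - f(x) = N / (M_0 - κ M_1)` with `N = 𝔼[(f - f(x)) (1 - κ s) χ]`.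

Expand `f` by Taylor in normal coordinates. Cap and weight are invariant under the isometries fixing
`x`, so odd terms average to zero, and the terms of order two and four reduce to traces times the
averages of `r ^ 2` and `r ^ 4`, where `r` is the geodesic distance (`avg_taylor`). Since `r ^ 2 = 2
s + s ^ 2 / 3 + O(s ^ 3)` and `r ^ 4 = 4 s ^ 2 + O(s ^ 3)`, up to controlled errors `N` is a
combination of `M_1 - κ M_2` and `M_2 - κ M_3` (`exists_abs_numerator_sub_le`).

By the choice of `κ`, `M_1 - κ M_2 = κ ε^(d+8)` exactly. As `κ` has order `ε^(-2)`, this is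
`O(ε^(d+6))`: the `ε ^ 2` term cancels, and with regularization order 8 it leaves nothing before `ε
^ 6`. The other difference is computed from `M_k = Z d / ((d + 2k) 2 ^ k) ε^(d+2k) (1 + O(ε ^ 2))`:
its ratio to `M_0 - κ M_1` is `-d (d + 2) / (4 (d + 4) (d + 6)) ε ^ 4 + O(ε ^ 6)`, and the
denominator is asymptotic to `4 Z / (d + 2) ^ 2 ε ^ d`, hence nonzero (`quotient_asymptotics`).

The law of `M_k` needs only that a cap has measure `Z ε ^ d (1 + O(ε ^ 2))`, integrated by the
layer-cake formula. The cap measure comes from squeezing the solid cone over the cap between two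
truncated cones, whose volumes scale exactly under linear maps (`exists_abs_cap_sub_le`). -/

open scoped Pointwise

noncomputable section

namespace LLE

/-! ### The uniform measure on the sphere -/

/-- The map of the sphere induced by a linear isometry. -/
def sphMap {d : ℕ} (L : EuclideanSpace ℝ (Fin (d + 1)) ≃ₗᵢ[ℝ] EuclideanSpace ℝ (Fin (d + 1)))
    (y : Sph d) : Sph d :=
  ⟨L y, by simp⟩

theorem continuous_sphMap {d : ℕ}
    (L : EuclideanSpace ℝ (Fin (d + 1)) ≃ₗᵢ[ℝ] EuclideanSpace ℝ (Fin (d + 1))) :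
    Continuous (sphMap L) :=
  (L.continuous.comp continuous_subtype_val).subtype_mk _

instance isFiniteMeasure_uniformSph (d : ℕ) : IsFiniteMeasure (uniformSph d) := by
  unfold uniformSph
  apply Measure.smul_finite
  simp only [ne_eq, ENNReal.inv_eq_top, Measure.measure_univ_eq_zero]
  exact Measure.toSphere_ne_zero _

/-- `toSphere` measures a set by the volume of the solid cone over it; the isometry carries cones to
cones and preserves volume. -/
theorem measurePreserving_sphMap {d : ℕ}
    (L : EuclideanSpace ℝ (Fin (d + 1)) ≃ₗᵢ[ℝ] EuclideanSpace ℝ (Fin (d + 1))) :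
    MeasurePreserving (sphMap L) (uniformSph d) (uniformSph d) := by
  refine ⟨(continuous_sphMap L).measurable, ?_⟩
  ext s hs
  rw [Measure.map_apply (continuous_sphMap L).measurable hs]
  simp only [uniformSph, Measure.smul_apply]
  congr 1
  rw [Measure.toSphere_apply' _ hs,
    Measure.toSphere_apply' _ ((continuous_sphMap L).measurable hs)]
  congr 1
  have h : Ioo (0 : ℝ) 1 • ((↑) '' (sphMap L ⁻¹' s) : Set (EuclideanSpace ℝ (Fin (d + 1))))
      = L ⁻¹' (Ioo (0 : ℝ) 1 • ((↑) '' s)) := by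
    ext z
    simp only [Set.mem_smul, mem_image, mem_preimage]
    constructor
    · rintro ⟨r, hr, _, ⟨y, hy, rfl⟩, rfl⟩
      exact ⟨r, hr, _, ⟨_, hy, rfl⟩, by simp [sphMap]⟩
    · rintro ⟨r, hr, _, ⟨y, hy, rfl⟩, h⟩
      refine ⟨r, hr, _, ⟨sphMap L.symm y, ?_, rfl⟩, ?_⟩
      · simpa [sphMap] using hy
      · simp only [sphMap]
        rw [← map_smul, h, L.symm_apply_apply]
  rw [h]
  have hm : MeasurePreserving L.toMeasurableEquiv volume volume := L.measurePreserving
  exact hm.measure_preimage_equiv _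

theorem integral_comp_sphMap {d : ℕ}
    (L : EuclideanSpace ℝ (Fin (d + 1)) ≃ₗᵢ[ℝ] EuclideanSpace ℝ (Fin (d + 1)))
    {F : Type*} [NormedAddCommGroup F] [NormedSpace ℝ F] (h : Sph d → F) :
    ∫ y, h (sphMap L y) ∂uniformSph d = ∫ y, h y ∂uniformSph d := by
  have hinj : Function.Injective (sphMap L) := by
    intro a b hab
    apply Subtype.ext
    exact L.injective (congrArg Subtype.val hab)
  exact (measurePreserving_sphMap L).integral_comp
    ((continuous_sphMap L).isClosedEmbedding hinj).measurableEmbedding h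

/-! ### The volume of small caps -/

/-- The linear map acting as `a` on the line of `x` and as `b` on its orthogonal complement. -/
def dilation {d : ℕ} (x : Sph d) (a b : ℝ) :
    EuclideanSpace ℝ (Fin (d + 1)) →ₗ[ℝ] EuclideanSpace ℝ (Fin (d + 1)) :=
  b • LinearMap.id + (a - b) • (innerₛₗ ℝ (x : EuclideanSpace ℝ (Fin (d + 1)))).smulRight
    (x : EuclideanSpace ℝ (Fin (d + 1)))

theorem dilation_apply {d : ℕ} (x : Sph d) (a b : ℝ) (z : EuclideanSpace ℝ (Fin (d + 1))) :
    dilation x a b z = b • z + ((a - b) * inner ℝ (x : EuclideanSpace ℝ (Fin (d + 1))) z) •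
      (x : EuclideanSpace ℝ (Fin (d + 1))) := by
  simp [dilation, smul_smul]

theorem inner_self_sph {d : ℕ} (x : Sph d) :
    inner ℝ (x : EuclideanSpace ℝ (Fin (d + 1))) (x : EuclideanSpace ℝ (Fin (d + 1))) = 1 := by
  rw [real_inner_self_eq_norm_sq, norm_eq_of_mem_sphere, one_pow]

/-- The map is `b` times a rank-one perturbation of the identity, so the matrix determinant lemma
applies; `b ≠ 0` is what permits factoring `b` out. -/
theorem det_dilation {d : ℕ} (x : Sph d) (a : ℝ) {b : ℝ} (hb : b ≠ 0) :
    LinearMap.det (dilation x a b) = a * b ^ d := by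
  set xv : Fin (d + 1) → ℝ := (x : EuclideanSpace ℝ (Fin (d + 1))).ofLp with hxv
  rw [← LinearMap.det_toMatrix (EuclideanSpace.basisFun (Fin (d + 1)) ℝ).toBasis]
  have : LinearMap.toMatrix (EuclideanSpace.basisFun (Fin (d + 1)) ℝ).toBasis
      (EuclideanSpace.basisFun (Fin (d + 1)) ℝ).toBasis (dilation x a b)
      = b • (1 + Matrix.replicateCol Unit (((a - b) / b) • xv) * Matrix.replicateRow Unit xv) := by
    ext i j
    rw [LinearMap.toMatrix_apply, dilation_apply]
    simp [Matrix.mul_apply, Matrix.one_apply, ← hxv, EuclideanSpace.inner_single_right]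
    split_ifs
    · field_simp
    · field_simp
      ring
  rw [this, Matrix.det_smul, Matrix.det_one_add_replicateCol_mul_replicateRow]
  have h1 : xv ⬝ᵥ xv = 1 := by
    have := inner_self_sph x
    rw [EuclideanSpace.inner_eq_star_dotProduct] at this
    simpa using this
  rw [dotProduct_smul, h1]
  simp [pow_succ]
  field_simp
  ring

/-- The truncated cone of aperture `T` and height `ℓ` around `x`. -/
def truncCone {d : ℕ} (x : Sph d) (T ℓ : ℝ) : Set (EuclideanSpace ℝ (Fin (d + 1))) :=
  {z | 0 < inner ℝ (x : EuclideanSpace ℝ (Fin (d + 1))) z ∧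
    inner ℝ (x : EuclideanSpace ℝ (Fin (d + 1))) z < ℓ ∧
    ‖z - inner ℝ (x : EuclideanSpace ℝ (Fin (d + 1))) z • (x : EuclideanSpace ℝ (Fin (d + 1)))‖
      < T * inner ℝ (x : EuclideanSpace ℝ (Fin (d + 1))) z}

theorem inner_dilation {d : ℕ} (x : Sph d) (a b : ℝ) (z : EuclideanSpace ℝ (Fin (d + 1))) :
    inner ℝ (x : EuclideanSpace ℝ (Fin (d + 1))) (dilation x a b z)
      = a * inner ℝ (x : EuclideanSpace ℝ (Fin (d + 1))) z := by
  rw [dilation_apply, inner_add_right, inner_smul_right, inner_smul_right, inner_self_sph]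
  ring

theorem dilation_sub_proj {d : ℕ} (x : Sph d) (a b : ℝ) (z : EuclideanSpace ℝ (Fin (d + 1))) :
    dilation x a b z - inner ℝ (x : EuclideanSpace ℝ (Fin (d + 1))) (dilation x a b z) •
      (x : EuclideanSpace ℝ (Fin (d + 1)))
      = b • (z - inner ℝ (x : EuclideanSpace ℝ (Fin (d + 1))) z •
        (x : EuclideanSpace ℝ (Fin (d + 1)))) := by
  rw [inner_dilation, dilation_apply]
  module

theorem truncCone_eq_preimage {d : ℕ} (x : Sph d) {T ℓ : ℝ} (hT : 0 < T) (hℓ : 0 < ℓ) :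
    truncCone x T ℓ = dilation x ℓ⁻¹ (T * ℓ)⁻¹ ⁻¹' truncCone x 1 1 := by
  ext z
  have h0 : 0 < T * ℓ := by positivity
  simp only [truncCone, mem_ofPred_eq, mem_preimage, dilation_sub_proj]
  simp only [inner_dilation, norm_smul, one_mul, Real.norm_eq_abs, abs_of_pos (inv_pos.2 h0)]
  refine and_congr ?_ (and_congr ?_ ?_)
  · constructor
    · intro h; positivity
    · intro h; exact (pos_iff_pos_of_mul_pos h).1 (by positivity)
  · rw [inv_mul_lt_iff₀ hℓ, mul_one]
  · rw [inv_mul_lt_iff₀ h0]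
    have : T * ℓ * (ℓ⁻¹ * inner ℝ (x : EuclideanSpace ℝ (Fin (d + 1))) z)
      = T * inner ℝ (x : EuclideanSpace ℝ (Fin (d + 1))) z := by field_simp
    rw [this]

/-- All truncated cones are linear images of the standard one, so only a determinant is needed and
the volume of `truncCone x 1 1` can stay unevaluated: it cancels in the end. -/
theorem volume_real_truncCone {d : ℕ} (x : Sph d) {T ℓ : ℝ} (hT : 0 < T) (hℓ : 0 < ℓ) :
    volume.real (truncCone x T ℓ) = T ^ d * ℓ ^ (d + 1) * volume.real (truncCone x 1 1) := by
  have h0 : (T * ℓ)⁻¹ ≠ 0 := by positivity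
  have hdet : LinearMap.det (dilation x ℓ⁻¹ (T * ℓ)⁻¹) ≠ 0 := by
    rw [det_dilation _ _ h0]; positivity
  rw [truncCone_eq_preimage x hT hℓ, measureReal_def, Measure.addHaar_preimage_linearMap _ hdet,
    ENNReal.toReal_mul, det_dilation _ _ h0, ENNReal.toReal_ofReal (abs_nonneg _),
    measureReal_def]
  congr 1
  rw [abs_of_pos (by positivity), mul_inv, inv_inv, inv_pow, inv_inv, mul_pow]
  ring

theorem norm_sq_eq_inner_sq_add {d : ℕ} (x : Sph d) (z : EuclideanSpace ℝ (Fin (d + 1))) :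
    ‖z‖ ^ 2 = inner ℝ (x : EuclideanSpace ℝ (Fin (d + 1))) z ^ 2 +
      ‖z - inner ℝ (x : EuclideanSpace ℝ (Fin (d + 1))) z •
        (x : EuclideanSpace ℝ (Fin (d + 1)))‖ ^ 2 := by
  rw [norm_sub_sq_real, norm_smul, inner_smul_right, real_inner_comm z, norm_eq_of_mem_sphere,
    Real.norm_eq_abs, mul_one, sq_abs]
  ring

theorem truncCone_subset_ball {d : ℕ} (x : Sph d) : truncCone x 1 1 ⊆ Metric.ball 0 2 := by
  rintro z ⟨h1, h2, h3⟩
  rw [mem_ball_zero_iff]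
  have := norm_sq_eq_inner_sq_add x z
  have h4 := norm_nonneg (z - inner ℝ (x : EuclideanSpace ℝ (Fin (d + 1))) z •
        (x : EuclideanSpace ℝ (Fin (d + 1))))
  nlinarith [norm_nonneg z]

theorem isOpen_truncCone {d : ℕ} (x : Sph d) (T ℓ : ℝ) : IsOpen (truncCone x T ℓ) := by
  simp only [truncCone, ofPred_and]
  refine (isOpen_lt ?_ ?_).inter ((isOpen_lt ?_ ?_).inter (isOpen_lt ?_ ?_)) <;> fun_prop

theorem volume_real_truncCone_pos {d : ℕ} (x : Sph d) : 0 < volume.real (truncCone x 1 1) := by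
  rw [measureReal_def, ENNReal.toReal_pos_iff]
  constructor
  · refine (isOpen_truncCone x 1 1).measure_pos volume ⟨(1 / 2 : ℝ) • (x : EuclideanSpace ℝ (Fin (d + 1))), ?_⟩
    simp only [truncCone, mem_ofPred_eq, inner_smul_right, inner_self_sph]
    norm_num
  · exact (measure_mono (truncCone_subset_ball x)).trans_lt measure_ball_lt_top

theorem dist_sq_sph {d : ℕ} (x y : Sph d) :
    ‖(y : EuclideanSpace ℝ (Fin (d + 1))) - x‖ ^ 2
      = 2 * (1 - inner ℝ (x : EuclideanSpace ℝ (Fin (d + 1))) y) := by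
  rw [norm_sub_sq_real, norm_eq_of_mem_sphere, norm_eq_of_mem_sphere, real_inner_comm]
  ring

theorem mem_nbhd_iff {d : ℕ} {x y : Sph d} {ε : ℝ} (hε : 0 < ε) :
    y ∈ nbhd (incl d) ε x ↔
      1 - ε ^ 2 / 2 < inner ℝ (x : EuclideanSpace ℝ (Fin (d + 1))) y := by
  have h := dist_sq_sph x y
  change dist (y : EuclideanSpace ℝ (Fin (d + 1))) x < ε ↔ _
  rw [dist_eq_norm, ← sq_lt_sq₀ (norm_nonneg _) hε.le, h]
  constructor <;> intro h <;> linarith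

theorem mem_nbhd_iff_norm {d : ℕ} {x y : Sph d} {ε : ℝ} :
    y ∈ nbhd (incl d) ε x ↔ ‖(y : EuclideanSpace ℝ (Fin (d + 1))) - x‖ < ε := by
  rw [← dist_eq_norm]; rfl

theorem measurableSet_nbhd {d : ℕ} (x : Sph d) (ε : ℝ) :
    MeasurableSet (nbhd (incl d) ε x) :=
  (Metric.isOpen_ball.preimage continuous_subtype_val).measurableSet

theorem mem_cone_nbhd_iff {d : ℕ} {x : Sph d} {ε : ℝ} (hε : 0 < ε) 
    {z : EuclideanSpace ℝ (Fin (d + 1))} :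
    z ∈ Ioo (0 : ℝ) 1 • ((↑) '' nbhd (incl d) ε x : Set (EuclideanSpace ℝ (Fin (d + 1)))) ↔
      0 < ‖z‖ ∧ ‖z‖ < 1 ∧
        (1 - ε ^ 2 / 2) * ‖z‖ < inner ℝ (x : EuclideanSpace ℝ (Fin (d + 1))) z := by
  simp only [Set.mem_smul, mem_image]
  constructor
  · rintro ⟨r, hr, _, ⟨y, hy, rfl⟩, rfl⟩
    rw [mem_nbhd_iff hε] at hy
    rw [norm_smul, norm_eq_of_mem_sphere, Real.norm_eq_abs, abs_of_pos hr.1, mul_one,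
      inner_smul_right]
    exact ⟨hr.1, hr.2, by nlinarith [hr.1]⟩
  · rintro ⟨h0, h1, h2⟩
    refine ⟨‖z‖, ⟨h0, h1⟩, _, ⟨⟨‖z‖⁻¹ • z, ?_⟩, ?_, rfl⟩, ?_⟩
    · simp [norm_smul, h0.ne']
    · rw [mem_nbhd_iff hε]
      simp only [inner_smul_right]
      rw [lt_inv_mul_iff₀ h0]
      linarith
    · simp [smul_smul, h0.ne']

/-- The cap has angular radius with cosine `1 - ε ^ 2 / 2`, and the aperture is its tangent.
Replacing the spherical lid by the tangent plane at height 1 enlarges the cone. -/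
theorem cone_nbhd_subset {d : ℕ} {x : Sph d} {ε : ℝ} (hε : 0 < ε) (hε1 : ε ≤ 1) :
    Ioo (0 : ℝ) 1 • ((↑) '' nbhd (incl d) ε x : Set (EuclideanSpace ℝ (Fin (d + 1)))) ⊆
      truncCone x (√(1 - (1 - ε ^ 2 / 2) ^ 2) / (1 - ε ^ 2 / 2)) 1 := by
  intro z hz
  rw [mem_cone_nbhd_iff hε] at hz
  obtain ⟨h0, h1, h2⟩ := hz
  have hc : 0 < 1 - ε ^ 2 / 2 := by nlinarith
  have hc1 : 0 ≤ 1 - (1 - ε ^ 2 / 2) ^ 2 := by nlinarith [sq_nonneg ε]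
  set c := 1 - ε ^ 2 / 2
  have hn := norm_sq_eq_inner_sq_add x z
  have hpos : 0 < inner ℝ (x : EuclideanSpace ℝ (Fin (d + 1))) z := lt_trans (by positivity) h2
  refine ⟨hpos, ?_, ?_⟩
  · have := real_inner_le_norm (x : EuclideanSpace ℝ (Fin (d + 1))) z
    rw [norm_eq_of_mem_sphere, one_mul] at this
    linarith
  · have hs := Real.sq_sqrt hc1
    set u := ‖z - inner ℝ (x : EuclideanSpace ℝ (Fin (d + 1))) z •
        (x : EuclideanSpace ℝ (Fin (d + 1)))‖
    set t := inner ℝ (x : EuclideanSpace ℝ (Fin (d + 1))) z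
    rw [div_mul_eq_mul_div, lt_div_iff₀ hc]
    apply lt_of_pow_lt_pow_left₀ 2 (by positivity)
    rw [mul_pow, mul_pow, hs]
    have : (c * ‖z‖) ^ 2 < t ^ 2 := by gcongr
    rw [mul_pow, hn] at this
    nlinarith

/-- Same aperture, but cut at the height of the rim of the cap, hence inside the unit ball. -/
theorem truncCone_subset_cone_nbhd {d : ℕ} {x : Sph d} {ε : ℝ} (hε : 0 < ε) :
    truncCone x (√(1 - (1 - ε ^ 2 / 2) ^ 2) / (1 - ε ^ 2 / 2)) (1 - ε ^ 2 / 2) ⊆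
    Ioo (0 : ℝ) 1 • ((↑) '' nbhd (incl d) ε x : Set (EuclideanSpace ℝ (Fin (d + 1)))) := by
  rintro z ⟨h0, h1, h2⟩
  rw [mem_cone_nbhd_iff hε]
  have hc : 0 < 1 - ε ^ 2 / 2 := h0.trans h1
  have hc1 : 0 ≤ 1 - (1 - ε ^ 2 / 2) ^ 2 := by nlinarith [sq_nonneg ε]
  set c := 1 - ε ^ 2 / 2
  have hn := norm_sq_eq_inner_sq_add x z
  have hs := Real.sq_sqrt hc1
  have hu := norm_nonneg (z - inner ℝ (x : EuclideanSpace ℝ (Fin (d + 1))) z •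
        (x : EuclideanSpace ℝ (Fin (d + 1))))
  set u := ‖z - inner ℝ (x : EuclideanSpace ℝ (Fin (d + 1))) z •
        (x : EuclideanSpace ℝ (Fin (d + 1)))‖
  set t := inner ℝ (x : EuclideanSpace ℝ (Fin (d + 1))) z
  rw [div_mul_eq_mul_div, lt_div_iff₀ hc] at h2
  have h3 : (u * c) ^ 2 < (√(1 - c ^ 2) * t) ^ 2 := by gcongr
  rw [mul_pow, mul_pow, hs] at h3
  have h4 : (c * ‖z‖) ^ 2 < t ^ 2 := by rw [mul_pow, hn]; linarith
  have h5 : c * ‖z‖ < t := lt_of_pow_lt_pow_left₀ 2 h0.le h4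
  refine ⟨?_, ?_, h5⟩
  · rw [norm_pos_iff]
    rintro rfl
    simp [t] at h0
  · by_contra! h
    nlinarith

/-- The constant in front of `ε ^ d` in the measure of the cap of radius `ε`. -/
def capConst {d : ℕ} (x : Sph d) : ℝ :=
  ((volume : Measure (EuclideanSpace ℝ (Fin (d + 1)))).toSphere.real univ)⁻¹ * (d + 1)
    * volume.real (truncCone x 1 1)

theorem capConst_pos {d : ℕ} (x : Sph d) : 0 < capConst x := by
  have h : 0 < (volume : Measure (EuclideanSpace ℝ (Fin (d + 1)))).toSphere.real univ := by
    rw [measureReal_def, ENNReal.toReal_pos_iff]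
    refine ⟨?_, measure_lt_top _ _⟩
    rw [pos_iff_ne_zero, Ne, Measure.measure_univ_eq_zero]
    exact Measure.toSphere_ne_zero _
  have := volume_real_truncCone_pos x
  unfold capConst
  positivity

theorem uniformSph_real_nbhd {d : ℕ} (x : Sph d) (ε : ℝ) :
    (uniformSph d).real (nbhd (incl d) ε x) =
      ((volume : Measure (EuclideanSpace ℝ (Fin (d + 1)))).toSphere.real univ)⁻¹ * (d + 1) *
      volume.real (Ioo (0 : ℝ) 1 •
        ((↑) '' nbhd (incl d) ε x : Set (EuclideanSpace ℝ (Fin (d + 1))))) := by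
  simp only [uniformSph, measureReal_def, Measure.smul_apply, smul_eq_mul]
  rw [Measure.toSphere_apply' _ (measurableSet_nbhd x ε)]
  rw [ENNReal.toReal_mul, ENNReal.toReal_inv, ENNReal.toReal_mul, ENNReal.toReal_natCast,
    finrank_euclideanSpace_fin]
  push_cast
  ring

theorem uniformSph_real_nbhd_le {d : ℕ} (x : Sph d) {ε : ℝ} (hε : 0 < ε) (hε1 : ε ≤ 1) :
    (uniformSph d).real (nbhd (incl d) ε x) ≤
      capConst x * (√(1 - (1 - ε ^ 2 / 2) ^ 2) / (1 - ε ^ 2 / 2)) ^ d := by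
  have hc : 0 < 1 - ε ^ 2 / 2 := by nlinarith
  have hc1 : 0 < 1 - (1 - ε ^ 2 / 2) ^ 2 := by nlinarith [pow_pos hε 2]
  have hT : 0 < √(1 - (1 - ε ^ 2 / 2) ^ 2) / (1 - ε ^ 2 / 2) := by positivity
  have hv := volume_real_truncCone x hT one_pos
  have hpos := volume_real_truncCone_pos x
  have hfin : volume (truncCone x (√(1 - (1 - ε ^ 2 / 2) ^ 2) / (1 - ε ^ 2 / 2)) 1) ≠ ⊤ := by
    intro h
    rw [measureReal_def, h, ENNReal.toReal_top] at hv
    have : 0 < (√(1 - (1 - ε ^ 2 / 2) ^ 2) / (1 - ε ^ 2 / 2)) ^ d * 1 ^ (d + 1) *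
      volume.real (truncCone x 1 1) := by positivity
    linarith
  have hle := measureReal_mono (cone_nbhd_subset (x := x) hε hε1) hfin
  rw [uniformSph_real_nbhd, capConst, mul_assoc _ (volume.real _)]
  gcongr
  rw [hv, one_pow] at hle
  linarith

theorem le_uniformSph_real_nbhd {d : ℕ} (x : Sph d) {ε : ℝ} (hε : 0 < ε) (hε1 : ε ≤ 1) :
    capConst x * ((√(1 - (1 - ε ^ 2 / 2) ^ 2) / (1 - ε ^ 2 / 2)) ^ d * (1 - ε ^ 2 / 2) ^ (d + 1)) ≤
    (uniformSph d).real (nbhd (incl d) ε x) := by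
  have hc : 0 < 1 - ε ^ 2 / 2 := by nlinarith
  have hc1 : 0 < 1 - (1 - ε ^ 2 / 2) ^ 2 := by nlinarith [pow_pos hε 2]
  have hT : 0 < √(1 - (1 - ε ^ 2 / 2) ^ 2) / (1 - ε ^ 2 / 2) := by positivity
  have hv := volume_real_truncCone x hT hc
  have hfin : volume (Ioo (0 : ℝ) 1 •
        ((↑) '' nbhd (incl d) ε x : Set (EuclideanSpace ℝ (Fin (d + 1))))) ≠ ⊤ := by
    refine ((measure_mono (t := Metric.ball 0 1) ?_).trans_lt measure_ball_lt_top).ne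
    intro z hz
    rw [mem_cone_nbhd_iff hε] at hz
    simpa using hz.2.1
  have hle := measureReal_mono (truncCone_subset_cone_nbhd (x := x) hε) hfin
  rw [uniformSph_real_nbhd, capConst, mul_assoc _ (volume.real _)]
  gcongr
  rw [hv] at hle
  linarith

/-- The chord over `[0, 1]` of a convex function lies above its graph. -/
theorem one_add_pow_le {u : ℝ} (h0 : 0 ≤ u) (h1 : u ≤ 1) (d : ℕ) :
    (1 + u) ^ d ≤ 1 + (2 ^ d - 1) * u := by
  induction d with
  | zero => simp
  | succ d ih =>
    have h2 : (1 : ℝ) ≤ 2 ^ d := one_le_pow₀ (by norm_num)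
    rw [pow_succ, pow_succ]
    nlinarith [mul_nonneg (mul_nonneg (sub_nonneg.2 h2) h0) (sub_nonneg.2 h1)]

/-- The measure of the cap of radius `ε` is a constant times `ε ^ d`, up to a relative error of
order `ε ^ 2`. -/
theorem exists_abs_cap_sub_le {d : ℕ} (x : Sph d) :
    ∃ K : ℝ, ∀ ε : ℝ, 0 < ε → ε ≤ 1 →
      |(uniformSph d).real (nbhd (incl d) ε x) - capConst x * ε ^ d| ≤ K * ε ^ (d + 2) := by
  refine ⟨capConst x * (2 ^ d + (d + 1)), fun ε hε hε1 => ?_⟩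
  have hZ := capConst_pos x
  have hup := uniformSph_real_nbhd_le x hε hε1
  have hlow := le_uniformSph_real_nbhd x hε hε1
  have hc : 0 < 1 - ε ^ 2 / 2 := by nlinarith
  -- With `c = 1 - ε ^ 2 / 2`, the squared sine is `ε ^ 2 - ε ^ 4 / 4`, so the sine lies between `ε
  -- c` and `ε`.
  have hT : √(1 - (1 - ε ^ 2 / 2) ^ 2) ≤ ε := by
    rw [Real.sqrt_le_left hε.le]
    nlinarith [sq_nonneg (ε ^ 2)]
  have hT' : ε * (1 - ε ^ 2 / 2) ≤ √(1 - (1 - ε ^ 2 / 2) ^ 2) := by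
    apply Real.le_sqrt_of_sq_le
    nlinarith [sq_nonneg (ε ^ 2), pow_pos hε 2, pow_pos hε 4,
      mul_nonneg (pow_pos hε 4).le (sub_nonneg.2 hε1)]
  have h1 : (√(1 - (1 - ε ^ 2 / 2) ^ 2) / (1 - ε ^ 2 / 2)) ^ d ≤ ε ^ d * (1 + 2 ^ d * ε ^ 2) := by
    have h2 : √(1 - (1 - ε ^ 2 / 2) ^ 2) / (1 - ε ^ 2 / 2) ≤ ε * (1 + ε ^ 2) := by
      rw [div_le_iff₀ hc]
      have : 1 ≤ (1 + ε ^ 2) * (1 - ε ^ 2 / 2) := by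
        nlinarith [mul_nonneg (pow_pos hε 2).le (sub_nonneg.2 hε1), pow_pos hε 2]
      nlinarith
    calc _ ≤ (ε * (1 + ε ^ 2)) ^ d := by gcongr
      _ = ε ^ d * (1 + ε ^ 2) ^ d := mul_pow _ _ _
      _ ≤ _ := by
        gcongr
        have := one_add_pow_le (pow_pos hε 2).le (by nlinarith) d
        nlinarith [pow_pos hε 2]
  have h3 : ε ^ d * (1 - (d + 1) * ε ^ 2) ≤
      (√(1 - (1 - ε ^ 2 / 2) ^ 2) / (1 - ε ^ 2 / 2)) ^ d * (1 - ε ^ 2 / 2) ^ (d + 1) := by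
    rw [div_pow, pow_succ (1 - ε ^ 2 / 2) d, ← mul_assoc, div_mul_cancel₀ _ (by positivity)]
    have hb := one_add_mul_le_pow (a := -(ε ^ 2 / 2)) (by nlinarith) (d + 1)
    push_cast at hb
    calc ε ^ d * (1 - (d + 1) * ε ^ 2) ≤ ε ^ d * (1 - ε ^ 2 / 2) ^ (d + 1) := by
          gcongr
          have h5 : 0 ≤ ((d : ℝ) + 1) * ε ^ 2 := by positivity
          have h6 : 1 - ε ^ 2 / 2 = 1 + -(ε ^ 2 / 2) := by ring
          rw [h6]
          linarith
      _ = (ε * (1 - ε ^ 2 / 2)) ^ d * (1 - ε ^ 2 / 2) := by rw [mul_pow, pow_succ]; ring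
      _ ≤ _ := by gcongr
  have h4 := mul_le_mul_of_nonneg_left h1 hZ.le
  have h5 := mul_le_mul_of_nonneg_left h3 hZ.le
  have h6 : 0 ≤ capConst x * ε ^ (d + 2) := by positivity
  have h7 : 0 ≤ capConst x * ε ^ (d + 2) * d := by positivity
  have h8 : 0 ≤ capConst x * ε ^ (d + 2) * 2 ^ d := by positivity
  rw [abs_le]
  rw [pow_add] at h6 h7 h8 ⊢
  constructor <;> nlinarith

/-! ### Moments from tail measures -/

/-- Layer-cake formula with density `(n + 1) t ^ n`, applied to the measure restricted to `τ < ε`;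
the tail `t ≤ τ < ε` is then a difference of two sublevel measures. No density of the law of `τ` is
required. -/
theorem setIntegral_pow_eq {α : Type*} [MeasurableSpace α] (μ : Measure α) [IsFiniteMeasure μ]
    {τ : α → ℝ} (hτ : Measurable τ) (h0 : ∀ a, 0 ≤ τ a) (n : ℕ) {ε : ℝ} (hε : 0 < ε) :
    ∫ a in {a | τ a < ε}, τ a ^ (n + 1) ∂μ =
      ∫ t in (0 : ℝ)..ε, (μ.real {a | τ a < ε} - μ.real {a | τ a < t}) * ((n + 1) * t ^ n) := by
  set ν := μ.restrict {a | τ a < ε} with hν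
  have hg : ∀ r : ℝ, ∫ t in (0 : ℝ)..r, ((n : ℝ) + 1) * t ^ n = r ^ (n + 1) := by
    intro r
    rw [intervalIntegral.integral_const_mul, integral_pow]
    have : (n : ℝ) + 1 ≠ 0 := by positivity
    field_simp
    simp
  have hlc := lintegral_comp_eq_lintegral_meas_le_mul ν (f := τ) (g := fun t => ((n : ℝ) + 1) * t ^ n)
    (Eventually.of_forall h0) hτ.aemeasurable
    (fun t _ => (by fun_prop : Continuous fun t : ℝ => ((n : ℝ) + 1) * t ^ n).intervalIntegrable _ _)
    ((ae_restrict_iff' measurableSet_Ioi).2 (Eventually.of_forall fun t ht => by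
      have : (0 : ℝ) < t := ht
      positivity))
  simp only [hg] at hlc
  have hanti : Antitone fun t => ν.real {a | t ≤ τ a} := fun s t hst =>
    measureReal_mono (fun a ha => le_trans hst ha)
  have h1 : ∫⁻ t in Ioi (0 : ℝ), ν {a | t ≤ τ a} * ENNReal.ofReal ((n + 1) * t ^ n)
      = ∫⁻ t in Ioi (0 : ℝ), ENNReal.ofReal (ν.real {a | t ≤ τ a} * ((n + 1) * t ^ n)) := by
    refine lintegral_congr fun t => ?_
    rw [ENNReal.ofReal_mul measureReal_nonneg, ofReal_measureReal]
  rw [integral_eq_lintegral_of_nonneg_ae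
    (Eventually.of_forall fun a => pow_nonneg (h0 a) _) (hτ.pow_const _).aestronglyMeasurable,
    hlc, h1, ← integral_eq_lintegral_of_nonneg_ae]
  · rw [intervalIntegral.integral_of_le hε.le]
    rw [setIntegral_eq_of_subset_of_forall_sdiff_eq_zero measurableSet_Ioi
      (Ioc_subset_Ioi_self : Ioc 0 ε ⊆ Ioi 0)]
    · refine setIntegral_congr_fun measurableSet_Ioc fun t ht => ?_
      congr 1
      have hset : {a | τ a < t} ⊆ {a | τ a < ε} := fun a ha => lt_of_lt_of_le ha ht.2
      rw [← measureReal_sdiff hset (measurableSet_lt hτ measurable_const), hν,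
        measureReal_restrict_apply (measurableSet_le measurable_const hτ)]
      congr 1
      ext a
      simp [and_comm]
    · intro t ht
      have h2 : ε < t := by
        by_contra! h
        exact ht.2 ⟨ht.1, h⟩
      have : ν.real {a | t ≤ τ a} = 0 := by
        rw [hν, measureReal_restrict_apply (measurableSet_le measurable_const hτ)]
        have : {a | t ≤ τ a} ∩ {a | τ a < ε} = ∅ := by
          ext a
          simp only [mem_inter_iff, mem_ofPred_eq, mem_empty_iff_false, iff_false, not_and, not_lt]
          intro h; linarith
        rw [this, measureReal_empty]
      simp [this]
  · refine (ae_restrict_iff' measurableSet_Ioi).2 (Eventually.of_forall fun t ht => ?_)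
    have : (0 : ℝ) < t := ht
    have := measureReal_nonneg (μ := ν) (s := {a | t ≤ τ a})
    simp only [Pi.zero_apply]
    positivity
  · exact (hanti.measurable.mul (by fun_prop)).aestronglyMeasurable

/-- If the measure of `{τ < t}` is `Z t ^ d` up to a relative error of order `t ^ 2`, then so are,
with the corresponding constants, the truncated moments of `τ`. -/
theorem abs_setIntegral_pow_sub_le {α : Type*} [MeasurableSpace α] (μ : Measure α)
    [IsFiniteMeasure μ] {τ : α → ℝ} (hτ : Measurable τ) (h0 : ∀ a, 0 ≤ τ a) {Z K : ℝ} {d : ℕ}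
    (hd : 0 < d)
    (hV : ∀ t : ℝ, 0 < t → t ≤ 1 → |μ.real {a | τ a < t} - Z * t ^ d| ≤ K * t ^ (d + 2))
    (n : ℕ) {ε : ℝ} (hε : 0 < ε) (hε1 : ε ≤ 1) :
    |∫ a in {a | τ a < ε}, τ a ^ n ∂μ - Z * d / (d + n) * ε ^ (d + n)|
      ≤ 2 * |K| * ε ^ (d + n + 2) := by
  have hd' : (0 : ℝ) < d := by exact_mod_cast hd
  have hK : ∀ t : ℝ, 0 < t → t ≤ ε →
      |μ.real {a | τ a < t} - Z * t ^ d| ≤ |K| * ε ^ (d + 2) := by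
    intro t ht htε
    refine (hV t ht (htε.trans hε1)).trans ?_
    calc K * t ^ (d + 2) ≤ |K| * t ^ (d + 2) := by gcongr; exact le_abs_self K
      _ ≤ _ := by gcongr
  -- The layer-cake formula needs a positive exponent; for exponent zero the integral is the measure
  -- itself.
  rcases n with _ | n
  · have h1 : Z * d / (d + (0 : ℕ)) = Z := by field_simp; simp
    simp only [pow_zero, integral_const, smul_eq_mul, mul_one, h1, add_zero]
    rw [measureReal_restrict_apply_univ]
    refine (hK ε hε le_rfl).trans ?_
    have : 0 ≤ |K| * ε ^ (d + 2) := by positivity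
    linarith
  · have hpoly : ∫ t in (0 : ℝ)..ε, (Z * ε ^ d - Z * t ^ d) * ((n + 1) * t ^ n)
        = Z * d / (d + (n + 1 : ℕ)) * ε ^ (d + (n + 1)) := by
      have h2 : ∀ t : ℝ, (Z * ε ^ d - Z * t ^ d) * ((n + 1) * t ^ n)
          = Z * ε ^ d * (n + 1) * t ^ n - Z * (n + 1) * t ^ (d + n) := by
        intro t; ring
      simp only [h2]
      rw [intervalIntegral.integral_sub
        ((by fun_prop : Continuous fun t : ℝ => Z * ε ^ d * (n + 1) * t ^ n).intervalIntegrable _ _)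
        ((by fun_prop : Continuous fun t : ℝ => Z * (n + 1) * t ^ (d + n)).intervalIntegrable _ _),
        intervalIntegral.integral_const_mul, intervalIntegral.integral_const_mul, integral_pow,
        integral_pow]
      push_cast
      have h3 : (d : ℝ) + n + 1 ≠ 0 := by positivity
      have h4 : (n : ℝ) + 1 ≠ 0 := by positivity
      have h5 : (d : ℝ) + (n + 1) ≠ 0 := by positivity
      field_simp
      ring
    have hmono : Monotone fun t => μ.real {a | τ a < t} := fun s t hst =>
      measureReal_mono (fun a ha => lt_of_lt_of_le ha hst)
    have hint1 : IntervalIntegrable (fun t => (μ.real {a | τ a < ε} - μ.real {a | τ a < t}) *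
        (((n : ℝ) + 1) * t ^ n)) volume 0 ε :=
      (intervalIntegrable_const.sub hmono.intervalIntegrable).mul_continuousOn
        (by fun_prop : Continuous fun t : ℝ => ((n : ℝ) + 1) * t ^ n).continuousOn
    have hint2 : IntervalIntegrable (fun t => (Z * ε ^ d - Z * t ^ d) *
        (((n : ℝ) + 1) * t ^ n)) volume 0 ε :=
      (by fun_prop : Continuous fun t : ℝ => (Z * ε ^ d - Z * t ^ d) *
        (((n : ℝ) + 1) * t ^ n)).intervalIntegrable _ _
    rw [setIntegral_pow_eq μ hτ h0 n hε, ← hpoly, ← intervalIntegral.integral_sub hint1 hint2]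
    -- The factor 2 accounts for the errors at the two radii `ε` and `t`, each at most `|K|
    -- ε^(d+2)`.
    have hb : ∫ t in (0 : ℝ)..ε, 2 * |K| * ε ^ (d + 2) * (((n : ℝ) + 1) * t ^ n)
        = 2 * |K| * ε ^ (d + (n + 1) + 2) := by
      rw [intervalIntegral.integral_const_mul, intervalIntegral.integral_const_mul, integral_pow]
      have h4 : (n : ℝ) + 1 ≠ 0 := by positivity
      field_simp
      ring
    rw [← hb, ← Real.norm_eq_abs]
    refine intervalIntegral.norm_integral_le_of_norm_le hε.le
      (Eventually.of_forall fun t ht => ?_)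
      ((by fun_prop : Continuous fun t : ℝ => 2 * |K| * ε ^ (d + 2) *
        (((n : ℝ) + 1) * t ^ n)).intervalIntegrable _ _)
    have ht0 : 0 < t := ht.1
    rw [← sub_mul, norm_mul, Real.norm_eq_abs, Real.norm_eq_abs,
      abs_of_nonneg (by positivity : 0 ≤ ((n : ℝ) + 1) * t ^ n)]
    gcongr
    have h6 := hK ε hε le_rfl
    have h7 := hK t ht0 ht.2
    rw [abs_le] at h6 h7 ⊢
    constructor <;> linarith [h6.1, h6.2, h7.1, h7.2]

/-- The truncated moments of the distance to `x`. -/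
theorem exists_abs_moment_sub_le {d : ℕ} (hd : 0 < d) (x : Sph d) :
    ∃ K : ℝ, 0 ≤ K ∧ ∀ (n : ℕ) (ε : ℝ), 0 < ε → ε ≤ 1 →
      |∫ y in nbhd (incl d) ε x, ‖(y : EuclideanSpace ℝ (Fin (d + 1))) - x‖ ^ n ∂uniformSph d
        - capConst x * d / (d + n) * ε ^ (d + n)| ≤ K * ε ^ (d + n + 2) := by
  obtain ⟨K, hK⟩ := exists_abs_cap_sub_le x
  have hset : ∀ ε, nbhd (incl d) ε x =
      {y : Sph d | ‖(y : EuclideanSpace ℝ (Fin (d + 1))) - x‖ < ε} := fun ε => by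
    ext y
    exact mem_nbhd_iff_norm
  simp only [hset] at hK ⊢
  exact ⟨2 * |K|, by positivity, fun n ε hε hε1 =>
    abs_setIntegral_pow_sub_le (uniformSph d)
      (τ := fun y : Sph d => ‖(y : EuclideanSpace ℝ (Fin (d + 1))) - x‖)
      (by fun_prop) (fun _ => norm_nonneg _) hd hK n hε hε1⟩

/-! ### Smoothness of the exponential map -/

/-- The ratio test gives an infinite radius of convergence, so the sum is analytic on the whole
line. -/
theorem contDiff_ofScalarsSum {c : ℕ → ℝ} (hc : ∀ n, c n ≠ 0)
    (h : Tendsto (fun n => ‖c n.succ‖ / ‖c n‖) atTop (𝓝 0)) {n : ℕ∞ω} :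
    ContDiff ℝ n (FormalMultilinearSeries.ofScalarsSum (E := ℝ) c) := by
  have hr : (FormalMultilinearSeries.ofScalars ℝ c).radius = ⊤ :=
    FormalMultilinearSeries.ofScalars_radius_eq_top_of_tendsto ℝ c (Eventually.of_forall hc) h
  have hf := (FormalMultilinearSeries.ofScalars ℝ c).hasFPowerSeriesOnBall (by rw [hr]; simp)
  rw [hr] at hf
  have := hf.analyticOnNhd
  rw [Metric.eball_top] at this
  exact this.contDiff

/-- The coefficients of the entire function `cos √t`. -/
def cosCoeff (n : ℕ) : ℝ := (-1) ^ n / (2 * n).factorial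

/-- The coefficients of the entire function `sinc √t`. -/
def sincCoeff (n : ℕ) : ℝ := (-1) ^ n / (2 * n + 1).factorial

theorem tendsto_cosCoeff :
    Tendsto (fun n => ‖cosCoeff n.succ‖ / ‖cosCoeff n‖) atTop (𝓝 0) := by
  refine squeeze_zero (fun n => by positivity) (fun n => ?_)
    (tendsto_one_div_add_atTop_nhds_zero_nat (𝕜 := ℝ))
  simp only [cosCoeff, norm_div, norm_pow, norm_neg, norm_one, one_pow, Real.norm_natCast]
  have h : (2 * n.succ).factorial = (2 * n + 2) * ((2 * n + 1) * (2 * n).factorial) := by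
    rw [show 2 * n.succ = 2 * n + 1 + 1 by omega, Nat.factorial_succ, Nat.factorial_succ]
  have hp : (0 : ℝ) < (2 * n).factorial := by exact_mod_cast Nat.factorial_pos _
  rw [h]
  push_cast
  rw [div_div_div_eq, one_mul, mul_one, div_le_div_iff₀ (by positivity) (by positivity)]
  nlinarith [mul_nonneg hp.le (Nat.cast_nonneg (α := ℝ) n),
    mul_nonneg (mul_nonneg hp.le (Nat.cast_nonneg (α := ℝ) n)) (Nat.cast_nonneg (α := ℝ) n)]

theorem tendsto_sincCoeff :
    Tendsto (fun n => ‖sincCoeff n.succ‖ / ‖sincCoeff n‖) atTop (𝓝 0) := by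
  refine squeeze_zero (fun n => by positivity) (fun n => ?_)
    (tendsto_one_div_add_atTop_nhds_zero_nat (𝕜 := ℝ))
  simp only [sincCoeff, norm_div, norm_pow, norm_neg, norm_one, one_pow, Real.norm_natCast]
  have h : (2 * n.succ + 1).factorial = (2 * n + 3) * ((2 * n + 2) * (2 * n + 1).factorial) := by
    rw [show 2 * n.succ + 1 = 2 * n + 1 + 1 + 1 by omega, Nat.factorial_succ, Nat.factorial_succ]
  have hp : (0 : ℝ) < (2 * n + 1).factorial := by exact_mod_cast Nat.factorial_pos _
  rw [h]
  push_cast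
  rw [div_div_div_eq, one_mul, mul_one, div_le_div_iff₀ (by positivity) (by positivity)]
  nlinarith [mul_nonneg hp.le (Nat.cast_nonneg (α := ℝ) n),
    mul_nonneg (mul_nonneg hp.le (Nat.cast_nonneg (α := ℝ) n)) (Nat.cast_nonneg (α := ℝ) n)]

theorem ofScalarsSum_cosCoeff (r : ℝ) :
    FormalMultilinearSeries.ofScalarsSum (E := ℝ) cosCoeff (r ^ 2) = Real.cos r := by
  rw [FormalMultilinearSeries.ofScalarsSum_eq_tsum, ← (Real.hasSum_cos r).tsum_eq]
  refine tsum_congr fun n => ?_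
  rw [cosCoeff, smul_eq_mul, ← pow_mul]
  ring

theorem ofScalarsSum_sincCoeff (r : ℝ) :
    FormalMultilinearSeries.ofScalarsSum (E := ℝ) sincCoeff (r ^ 2) = Real.sinc r := by
  by_cases hr : r = 0
  · subst hr
    simp [FormalMultilinearSeries.ofScalarsSum_zero, sincCoeff]
  rw [FormalMultilinearSeries.ofScalarsSum_eq_tsum, Real.sinc_of_ne_zero hr,
    ← (Real.hasSum_sin r).tsum_eq, ← tsum_div_const]
  refine tsum_congr fun n => ?_
  rw [sincCoeff, smul_eq_mul, ← pow_mul]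
  field_simp
  rw [pow_succ]

/-- The norm is not differentiable at the origin, but `cos` is even, hence an entire function of the
smooth quantity `‖v‖ ^ 2`. The same applies to `sinc`. -/
theorem contDiff_cos_norm {V : Type*} [NormedAddCommGroup V] [InnerProductSpace ℝ V] {n : ℕ∞ω} :
    ContDiff ℝ n fun v : V => Real.cos ‖v‖ := by
  have h := (contDiff_ofScalarsSum (n := n) (c := cosCoeff)
    (fun n => by unfold cosCoeff; positivity) tendsto_cosCoeff).comp (contDiff_norm_sq ℝ (E := V))
  have he : (fun v : V => Real.cos ‖v‖) =
      FormalMultilinearSeries.ofScalarsSum (E := ℝ) cosCoeff ∘ fun v : V => ‖v‖ ^ 2 := by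
    ext v
    simp [ofScalarsSum_cosCoeff]
  rw [he]
  exact h

theorem contDiff_sinc_norm {V : Type*} [NormedAddCommGroup V] [InnerProductSpace ℝ V] {n : ℕ∞ω} :
    ContDiff ℝ n fun v : V => Real.sinc ‖v‖ := by
  have h := (contDiff_ofScalarsSum (n := n) (c := sincCoeff)
    (fun n => by unfold sincCoeff; positivity) tendsto_sincCoeff).comp
      (contDiff_norm_sq ℝ (E := V))
  have he : (fun v : V => Real.sinc ‖v‖) =
      FormalMultilinearSeries.ofScalarsSum (E := ℝ) sincCoeff ∘ fun v : V => ‖v‖ ^ 2 := by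
    ext v
    simp [ofScalarsSum_sincCoeff]
  rw [he]
  exact h

theorem contDiff_inNormalCoord {d : ℕ} (x : Sph d) (b : OrthonormalBasis (Fin d) ℝ (Tan x))
    {f : Sph d → ℝ} {n : ℕ∞ω} (hf : ContMDiff (𝓡 d) 𝓘(ℝ, ℝ) n f) :
    ContDiff ℝ n (inNormalCoord x b f) := by
  rw [← contMDiff_iff_contDiff]
  have hlin : ContDiff ℝ n fun v : EuclideanSpace ℝ (Fin d) => ∑ i, v i • b i := by
    fun_prop
  have h1 : ContDiff ℝ n fun v : EuclideanSpace ℝ (Fin d) =>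
      ((expMap x (∑ i, v i • b i) : Sph d) : EuclideanSpace ℝ (Fin (d + 1))) := by
    refine ((contDiff_cos_norm.comp hlin).smul contDiff_const).add
      ((contDiff_sinc_norm.comp hlin).smul ((Tan x).subtypeL.contDiff.comp hlin))
  have h2 := h1.contMDiff.codRestrict_sphere (n := d)
    (fun v => (expMap x (∑ i, v i • b i)).2)
  exact hf.comp h2

/-! ### Taylor's formula in several variables -/

theorem iteratedDeriv_comp_smul_eq {V : Type*} [NormedAddCommGroup V] [NormedSpace ℝ V] {g : V → ℝ}
    {n : ℕ∞ω} (hg : ContDiff ℝ n g) {k : ℕ} (hk : k ≤ n) (v : V) (t : ℝ) :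
    iteratedDeriv k (fun s : ℝ => g (s • v)) t = iteratedFDeriv ℝ k g (t • v) fun _ => v := by
  have h := ContinuousLinearMap.iteratedFDeriv_comp_right
    (ContinuousLinearMap.toSpanSingleton ℝ v) hg t hk
  rw [iteratedDeriv_eq_iteratedFDeriv]
  have h2 : (g ∘ (ContinuousLinearMap.toSpanSingleton ℝ v)) = fun s : ℝ => g (s • v) := by
    ext s; simp
  rw [← h2, h]
  simp

/-- Lagrange's remainder for `s ↦ g (s • v)` on `[0, 1]`; compactness of the unit ball makes the
constant uniform in `v`. -/
theorem exists_abs_sub_taylor_le {V : Type*} [NormedAddCommGroup V] [NormedSpace ℝ V]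
    [FiniteDimensional ℝ V] {g : V → ℝ} {n : ℕ} (hg : ContDiff ℝ (n + 1) g) :
    ∃ K : ℝ, 0 ≤ K ∧ ∀ v : V, ‖v‖ ≤ 1 →
      |g v - ∑ k ∈ Finset.range (n + 1), (k.factorial : ℝ)⁻¹ * iteratedFDeriv ℝ k g 0 fun _ => v|
        ≤ K * ‖v‖ ^ (n + 1) := by
  have hcont : Continuous fun w : V => ‖iteratedFDeriv ℝ (n + 1) g w‖ :=
    (hg.continuous_iteratedFDeriv (by norm_cast)).norm
  obtain ⟨K, hK⟩ := (isCompact_closedBall (0 : V) 1).bddAbove_image hcont.continuousOn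
  have hK' : ∀ w : V, ‖w‖ ≤ 1 → ‖iteratedFDeriv ℝ (n + 1) g w‖ ≤ K := fun w hw =>
    hK ⟨w, by simpa using hw, rfl⟩
  have hK0 : 0 ≤ K := (norm_nonneg _).trans (hK' 0 (by simp))
  refine ⟨K, hK0, fun v hv => ?_⟩
  have hline : ContDiff ℝ (n + 1) fun s : ℝ => g (s • v) := hg.comp (by fun_prop)
  obtain ⟨t, ht, h⟩ := taylor_mean_remainder_lagrange_iteratedDeriv (zero_ne_one (α := ℝ))
    (hline.contDiffOn (s := uIcc 0 1))
  have hsum : taylorWithinEval (fun s : ℝ => g (s • v)) n (uIcc 0 1) 0 1 =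
      ∑ k ∈ Finset.range (n + 1), (k.factorial : ℝ)⁻¹ * iteratedFDeriv ℝ k g 0 fun _ => v := by
    rw [taylor_within_apply]
    refine Finset.sum_congr rfl fun k hk => ?_
    have hk' : (k : ℕ∞ω) ≤ n + 1 := by
      have := Finset.mem_range.1 hk
      exact_mod_cast this.le
    have hw : iteratedDerivWithin k (fun s : ℝ => g (s • v)) (uIcc 0 1) 0
        = iteratedDeriv k (fun s : ℝ => g (s • v)) 0 := by
      rw [iteratedDeriv_eq_iteratedFDeriv, iteratedDerivWithin_eq_iteratedFDerivWithin,
        iteratedFDerivWithin_eq_iteratedFDeriv (uniqueDiffOn_uIcc zero_ne_one) _ left_mem_uIcc]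
      exact (hline.of_le hk').contDiffAt
    rw [hw, iteratedDeriv_comp_smul_eq hg hk']
    simp
  simp only [one_smul] at h
  rw [hsum] at h
  rw [h, iteratedDeriv_comp_smul_eq hg (by norm_cast), sub_zero, one_pow, mul_one, abs_div,
    Nat.abs_cast]
  rw [uIoo_of_lt zero_lt_one] at ht
  have h1 : ‖t • v‖ ≤ 1 := by
    rw [norm_smul, Real.norm_eq_abs, abs_of_pos ht.1]
    nlinarith [norm_nonneg v, ht.1, ht.2]
  have h2 : |iteratedFDeriv ℝ (n + 1) g (t • v) fun _ => v| ≤ K * ‖v‖ ^ (n + 1) := by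
    have := (iteratedFDeriv ℝ (n + 1) g (t • v)).le_opNorm fun _ => v
    rw [Finset.prod_const, Finset.card_univ, Fintype.card_fin] at this
    exact this.trans (by gcongr; exact hK' _ h1)
  have h3 : (1 : ℝ) ≤ (n + 1).factorial := by exact_mod_cast Nat.factorial_pos _
  exact (div_le_self (abs_nonneg _) h3).trans h2

/-! ### Symmetry of iterated derivatives -/

/-- The first two slots are the two outermost derivatives, so this is the symmetry of the second
derivative of `iteratedFDeriv ℝ k g`. -/
theorem iteratedFDeriv_swap_zero_one {V : Type*} [NormedAddCommGroup V] [NormedSpace ℝ V]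
    {g : V → ℝ} {n : ℕ∞ω} {k : ℕ} (hg : ContDiff ℝ n g) (hk : (k + 2 : ℕ) ≤ n) (x a b : V)
    (w : Fin k → V) :
    iteratedFDeriv ℝ (k + 2) g x (Matrix.vecCons a (Matrix.vecCons b w)) =
      iteratedFDeriv ℝ (k + 2) g x (Matrix.vecCons b (Matrix.vecCons a w)) := by
  have hF : ContDiff ℝ 2 (iteratedFDeriv ℝ k g) := by
    refine hg.iteratedFDeriv_right ?_
    refine le_trans ?_ hk
    rw [add_comm]; norm_cast
  have key : ∀ a b : V, iteratedFDeriv ℝ (k + 2) g x (Matrix.vecCons a (Matrix.vecCons b w)) =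
      fderiv ℝ (fderiv ℝ (iteratedFDeriv ℝ k g)) x a b w := by
    intro a b
    rw [iteratedFDeriv_succ_apply_left]
    simp only [Matrix.cons_val_zero]
    have htail : Fin.tail (Matrix.vecCons a (Matrix.vecCons b w)) = Matrix.vecCons b w := rfl
    rw [htail]
    have h1 : DifferentiableAt ℝ (iteratedFDeriv ℝ (k + 1) g) x :=
      (hg.differentiable_iteratedFDeriv (lt_of_lt_of_le (by norm_cast; omega) hk)) x
    have h2 : DifferentiableAt ℝ (fderiv ℝ (iteratedFDeriv ℝ k g)) x :=
      ((hF.fderiv_right (m := 1) (by norm_num)).differentiable (by norm_num)) x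
    have h3 : fderiv ℝ (fun y => iteratedFDeriv ℝ (k + 1) g y (Matrix.vecCons b w)) x a =
        fderiv ℝ (iteratedFDeriv ℝ (k + 1) g) x a (Matrix.vecCons b w) := by
      have := (h1.hasFDerivAt.continuousMultilinear_apply_const (Matrix.vecCons b w)).fderiv
      rw [this]; rfl
    have h4 : fderiv ℝ (fun y => fderiv ℝ (iteratedFDeriv ℝ k g) y b w) x a =
        fderiv ℝ (fderiv ℝ (iteratedFDeriv ℝ k g)) x a b w := by
      have h5 := (h2.hasFDerivAt.clm_apply (hasFDerivAt_const b x)).continuousMultilinear_apply_const w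
      rw [h5.fderiv]
      simp
    rw [← h3, ← h4]
    congr 2
  rw [key, key]
  have hs : IsSymmSndFDerivAt ℝ (iteratedFDeriv ℝ k g) x :=
    hF.contDiffAt.isSymmSndFDerivAt (by simp)
  rw [hs.eq]

/-! ### Normal coordinates of a point of the sphere -/

/-- The component of `exp_x⁻¹ y` along the tangent vector `θ`. -/
def logComp {d : ℕ} (x : Sph d) (θ : EuclideanSpace ℝ (Fin (d + 1))) (y : Sph d) : ℝ :=
  (Real.sinc (Real.arccos (inner ℝ (x : EuclideanSpace ℝ (Fin (d + 1))) y)))⁻¹ *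
    inner ℝ θ (y : EuclideanSpace ℝ (Fin (d + 1)))

/-- The normal coordinates of `y` at `x` with respect to an orthonormal basis. -/
def logCoord {d : ℕ} (x : Sph d) (b : OrthonormalBasis (Fin d) ℝ (Tan x)) (y : Sph d) :
    EuclideanSpace ℝ (Fin d) :=
  WithLp.toLp 2 fun i => logComp x (b i) y

/-- The tangential part of `y`. -/
def tanPart {d : ℕ} (x y : Sph d) : Tan x :=
  ⟨y - inner ℝ (x : EuclideanSpace ℝ (Fin (d + 1))) y • (x : EuclideanSpace ℝ (Fin (d + 1))), by
    rw [Submodule.mem_orthogonal_singleton_iff_inner_right, inner_sub_right, inner_smul_right,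
      inner_self_sph]
    ring⟩

theorem inner_tan {d : ℕ} {x : Sph d} (v : Tan x) :
    inner ℝ (x : EuclideanSpace ℝ (Fin (d + 1))) (v : EuclideanSpace ℝ (Fin (d + 1))) = 0 :=
  Submodule.mem_orthogonal_singleton_iff_inner_right.mp v.2

theorem norm_tanPart {d : ℕ} (x y : Sph d) :
    ‖tanPart x y‖ = Real.sin (Real.arccos (inner ℝ (x : EuclideanSpace ℝ (Fin (d + 1))) y)) := by
  have h := norm_sq_eq_inner_sq_add x (y : EuclideanSpace ℝ (Fin (d + 1)))
  rw [norm_eq_of_mem_sphere] at h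
  rw [Real.sin_arccos, ← Real.sqrt_sq (norm_nonneg (tanPart x y)), Submodule.coe_norm]
  congr 1
  simp only [tanPart]
  linarith

theorem abs_inner_sph_le {d : ℕ} (x y : Sph d) :
    |inner ℝ (x : EuclideanSpace ℝ (Fin (d + 1))) (y : EuclideanSpace ℝ (Fin (d + 1)))| ≤ 1 := by
  have := abs_real_inner_le_norm (x : EuclideanSpace ℝ (Fin (d + 1))) y
  simpa using this

/-- Jordan's inequality. It serves to divide by `sinc` on the open hemisphere. -/
theorem two_div_pi_le_sinc_arccos {t : ℝ} (ht : 0 < t) :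
    2 / Real.pi ≤ Real.sinc (Real.arccos t) := by
  have hpi := Real.pi_gt_three
  by_cases h : Real.arccos t = 0
  · rw [h, Real.sinc_zero, div_le_one (by positivity)]
    linarith
  · have h0 : 0 < Real.arccos t := lt_of_le_of_ne (Real.arccos_nonneg t) (Ne.symm h)
    rw [Real.sinc_of_ne_zero h, le_div_iff₀ h0]
    exact Real.mul_le_sin h0.le (Real.arccos_le_pi_div_two.2 ht.le)

theorem sinc_arccos_pos {t : ℝ} (ht : 0 < t) : 0 < Real.sinc (Real.arccos t) :=
  lt_of_lt_of_le (by positivity) (two_div_pi_le_sinc_arccos ht)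

theorem sinc_mul_self (r : ℝ) : Real.sinc r * r = Real.sin r := by
  by_cases h : r = 0
  · simp [h]
  · rw [Real.sinc_of_ne_zero h, div_mul_cancel₀ _ h]

theorem inner_basis_eq {d : ℕ} (x : Sph d) (b : OrthonormalBasis (Fin d) ℝ (Tan x)) (y : Sph d)
    (i : Fin d) : inner ℝ (b i : EuclideanSpace ℝ (Fin (d + 1))) (y : EuclideanSpace ℝ (Fin (d + 1)))
      = b.repr (tanPart x y) i := by
  rw [OrthonormalBasis.repr_apply_apply, Submodule.coe_inner]
  simp only [tanPart, inner_sub_right, inner_smul_right]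
  rw [real_inner_comm (x : EuclideanSpace ℝ (Fin (d + 1))), inner_tan]
  ring

theorem logCoord_eq {d : ℕ} (x : Sph d) (b : OrthonormalBasis (Fin d) ℝ (Tan x)) (y : Sph d) :
    logCoord x b y = (Real.sinc (Real.arccos (inner ℝ (x : EuclideanSpace ℝ (Fin (d + 1))) y)))⁻¹ •
      b.repr (tanPart x y) := by
  ext i
  simp [logCoord, logComp, inner_basis_eq]

theorem norm_logCoord {d : ℕ} (x : Sph d) (b : OrthonormalBasis (Fin d) ℝ (Tan x)) {y : Sph d}
    (h : 0 < inner ℝ (x : EuclideanSpace ℝ (Fin (d + 1))) (y : EuclideanSpace ℝ (Fin (d + 1)))) :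
    ‖logCoord x b y‖ = Real.arccos (inner ℝ (x : EuclideanSpace ℝ (Fin (d + 1))) y) := by
  have hs := sinc_arccos_pos h
  rw [logCoord_eq, norm_smul, LinearIsometryEquiv.norm_map, norm_tanPart, ← sinc_mul_self,
    norm_inv, Real.norm_eq_abs, abs_of_pos hs, inv_mul_cancel_left₀ hs.ne']

theorem sum_logCoord_smul {d : ℕ} (x : Sph d) (b : OrthonormalBasis (Fin d) ℝ (Tan x)) (y : Sph d) :
    ∑ i, logCoord x b y i • b i =
      (Real.sinc (Real.arccos (inner ℝ (x : EuclideanSpace ℝ (Fin (d + 1))) y)))⁻¹ • tanPart x y := by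
  conv_rhs => rw [← b.sum_repr (tanPart x y), Finset.smul_sum]
  refine Finset.sum_congr rfl fun i _ => ?_
  rw [logCoord_eq, smul_smul]
  rfl

/-- On the open hemisphere `logCoord` is a section of the exponential map: its norm is the angle to
`x`, and the two `sinc` factors cancel. -/
theorem inNormalCoord_logCoord {d : ℕ} (x : Sph d) (b : OrthonormalBasis (Fin d) ℝ (Tan x))
    (f : Sph d → ℝ) {y : Sph d}
    (h : 0 < inner ℝ (x : EuclideanSpace ℝ (Fin (d + 1))) (y : EuclideanSpace ℝ (Fin (d + 1)))) :
    inNormalCoord x b f (logCoord x b y) = f y := by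
  have hs := sinc_arccos_pos h
  rw [inNormalCoord]
  congr 1
  have hn : ‖∑ i, logCoord x b y i • b i‖ =
      Real.arccos (inner ℝ (x : EuclideanSpace ℝ (Fin (d + 1))) y) := by
    rw [sum_logCoord_smul, norm_smul, norm_tanPart, ← sinc_mul_self,
      norm_inv, Real.norm_eq_abs, abs_of_pos hs, inv_mul_cancel_left₀ hs.ne']
  apply Subtype.ext
  simp only [expMap]
  rw [hn, sum_logCoord_smul, Submodule.coe_smul, smul_smul, mul_inv_cancel₀ hs.ne', one_smul,
    Real.cos_arccos (abs_le.1 (abs_inner_sph_le x y)).1 (abs_le.1 (abs_inner_sph_le x y)).2]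
  simp [tanPart]

theorem inNormalCoord_zero {d : ℕ} (x : Sph d) (b : OrthonormalBasis (Fin d) ℝ (Tan x))
    (f : Sph d → ℝ) : inNormalCoord x b f 0 = f x := by
  rw [inNormalCoord]
  congr 1
  apply Subtype.ext
  simp [expMap]

/-! ### Comparison of the geodesic and the chordal distance -/

/-- Real part of the exponential remainder at `i r` after six terms, the odd ones being imaginary.
-/
theorem abs_cos_sub_le {r : ℝ} (hr : |r| ≤ 1) :
    |Real.cos r - (1 - r ^ 2 / 2 + r ^ 4 / 24)| ≤ |r| ^ 6 := by
  have hb := Complex.exp_bound (x := r * Complex.I) (by simpa using hr) (n := 6) (by norm_num)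
  have hre : (Complex.exp (r * Complex.I) -
      ∑ m ∈ Finset.range 6, (r * Complex.I) ^ m / (m.factorial : ℂ)).re =
      Real.cos r - (1 - r ^ 2 / 2 + r ^ 4 / 24) := by
    rw [Complex.sub_re, Complex.exp_ofReal_mul_I_re]
    congr 1
    simp only [Finset.sum_range_succ, Finset.sum_range_zero, mul_pow, Nat.factorial]
    have h3 : Complex.I ^ 3 = -Complex.I := Complex.I_pow_three
    have h4 : Complex.I ^ 4 = 1 := Complex.I_pow_four
    have h5 : Complex.I ^ 5 = Complex.I := by rw [pow_succ, h4, one_mul]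
    rw [h3, h4, h5, Complex.I_sq]
    have : (0 : ℂ) + (r : ℂ) ^ 0 * Complex.I ^ 0 / ((1 : ℕ) : ℂ) + (r : ℂ) ^ 1 * Complex.I ^ 1 / (((0 + 1) * 1 : ℕ) : ℂ)
        + (r : ℂ) ^ 2 * -1 / (((1 + 1) * ((0 + 1) * 1) : ℕ) : ℂ)
        + (r : ℂ) ^ 3 * -Complex.I / (((2 + 1) * ((1 + 1) * ((0 + 1) * 1)) : ℕ) : ℂ)
        + (r : ℂ) ^ 4 * 1 / (((3 + 1) * ((2 + 1) * ((1 + 1) * ((0 + 1) * 1))) : ℕ) : ℂ)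
        + (r : ℂ) ^ 5 * Complex.I / (((4 + 1) * ((3 + 1) * ((2 + 1) * ((1 + 1) * ((0 + 1) * 1)))) : ℕ) : ℂ)
        = ((1 - r ^ 2 / 2 + r ^ 4 / 24 : ℝ) : ℂ)
          + ((r - r ^ 3 / 6 + r ^ 5 / 120 : ℝ) : ℂ) * Complex.I := by
      push_cast
      ring
    rw [this, Complex.add_re, Complex.ofReal_re, Complex.re_ofReal_mul, Complex.I_re]
    ring
  rw [← hre]
  refine (Complex.abs_re_le_norm _).trans (hb.trans ?_)
  simp only [norm_mul, Complex.norm_real, Complex.norm_I, mul_one, Real.norm_eq_abs]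
  have : (6 : ℕ).succ * ((Nat.factorial 6 : ℝ) * ((6 : ℕ) : ℝ))⁻¹ ≤ (1 : ℝ) := by
    norm_num [Nat.factorial]
  calc _ ≤ |r| ^ 6 * 1 := by gcongr
    _ = _ := mul_one _

/-- If `τ` is the chord of an arc of length `r`, then `r = O(τ)`, `r ^ 2 = τ ^ 2 + τ ^ 4 / 12 +
O(τ ^ 6)` and `r ^ 4 = τ ^ 4 + O(τ ^ 6)`. -/
theorem arc_chord_bounds {r τ : ℝ} (hr0 : 0 ≤ r) (hrπ : r ≤ Real.pi) (hτ0 : 0 ≤ τ) (hτ : τ ≤ 1 / 2)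
    (h : τ ^ 2 = 2 * (1 - Real.cos r)) :
    r ≤ 2 * τ ∧ |r ^ 2 - (τ ^ 2 + τ ^ 4 / 12)| ≤ 1000 * τ ^ 6 ∧ |r ^ 4 - τ ^ 4| ≤ 1000 * τ ^ 6 := by
  have hq := Real.cos_le_one_sub_mul_cos_sq (by rwa [abs_of_nonneg hr0])
  have hpi : 2 / Real.pi ^ 2 ≥ 1 / 8 := by
    rw [ge_iff_le, div_le_div_iff₀ (by norm_num) (by positivity)]
    nlinarith [Real.pi_le_four, Real.pi_pos]
  -- From `cos r ≤ 1 - (2 / π ^ 2) r ^ 2` and `π ≤ 4`, `τ ^ 2 ≥ r ^ 2 / 4`.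
  have h1 : r ≤ 2 * τ := by
    apply le_of_sq_le_sq _ (by positivity)
    nlinarith [sq_nonneg r]
  have hr1 : r ≤ 1 := by linarith
  have hc := abs_cos_sub_le (r := r) (by rwa [abs_of_nonneg hr0])
  rw [abs_of_nonneg hr0] at hc
  set δ := Real.cos r - (1 - r ^ 2 / 2 + r ^ 4 / 24) with hδ
  have hτ2 : τ ^ 2 = r ^ 2 - (r ^ 4 / 12 + 2 * δ) := by rw [h, hδ]; ring
  have hr6 : r ^ 6 ≤ 64 * τ ^ 6 := by
    calc r ^ 6 ≤ (2 * τ) ^ 6 := by gcongr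
      _ = _ := by ring
  have hr64 : r ^ 6 ≤ r ^ 4 := pow_le_pow_of_le_one hr0 hr1 (by norm_num)
  have hη : |r ^ 4 / 12 + 2 * δ| ≤ 3 * r ^ 4 := by
    rw [abs_le] at hc ⊢
    have : 0 ≤ r ^ 4 := by positivity
    constructor <;> linarith [hc.1, hc.2]
  set η := r ^ 4 / 12 + 2 * δ with hηdef
  -- Together with `r ^ 6 ≤ 64 τ ^ 6` this gives `15 * 64 = 960`, whence the constant 1000.
  have hrest : |2 * r ^ 2 * η - η ^ 2| ≤ 15 * r ^ 6 := by
    have e1 : |2 * r ^ 2 * η| ≤ 6 * r ^ 6 := by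
      rw [abs_mul, abs_of_nonneg (by positivity : 0 ≤ 2 * r ^ 2)]
      calc 2 * r ^ 2 * |η| ≤ 2 * r ^ 2 * (3 * r ^ 4) := by gcongr
        _ = _ := by ring
    have e2 : |η ^ 2| ≤ 9 * r ^ 6 := by
      rw [abs_pow]
      calc |η| ^ 2 ≤ (3 * r ^ 4) ^ 2 := by gcongr
        _ = 9 * r ^ 8 := by ring
        _ ≤ _ := by
          have := pow_le_pow_of_le_one hr0 hr1 (by norm_num : 6 ≤ 8)
          linarith
    exact (abs_sub _ _).trans (by linarith)
  have hτ4 : τ ^ 4 = r ^ 4 - (2 * r ^ 2 * η - η ^ 2) := by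
    have : τ ^ 4 = (τ ^ 2) ^ 2 := by ring
    rw [this, hτ2]; ring
  refine ⟨h1, ?_, ?_⟩
  · have e : r ^ 2 - (τ ^ 2 + τ ^ 4 / 12) = 2 * δ + (2 * r ^ 2 * η - η ^ 2) / 12 := by
      rw [hτ2, hτ4, hηdef]; ring
    rw [e]
    rw [abs_le] at hc hrest ⊢
    constructor <;> linarith [hc.1, hc.2, hrest.1, hrest.2]
  · have : 0 ≤ τ ^ 6 := by positivity
    rw [hτ4, sub_sub_cancel]
    linarith

theorem arccos_chord_bounds {d : ℕ} (x y : Sph d)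
    (hτ : ‖(y : EuclideanSpace ℝ (Fin (d + 1))) - x‖ ≤ 1 / 2) :
    let r := Real.arccos (inner ℝ (x : EuclideanSpace ℝ (Fin (d + 1))) y)
    let τ := ‖(y : EuclideanSpace ℝ (Fin (d + 1))) - x‖
    r ≤ 2 * τ ∧ |r ^ 2 - (τ ^ 2 + τ ^ 4 / 12)| ≤ 1000 * τ ^ 6 ∧ |r ^ 4 - τ ^ 4| ≤ 1000 * τ ^ 6 := by
  refine arc_chord_bounds (Real.arccos_nonneg _) (Real.arccos_le_pi _) (norm_nonneg _) hτ ?_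
  rw [dist_sq_sph, Real.cos_arccos (abs_le.1 (abs_inner_sph_le x y)).1
    (abs_le.1 (abs_inner_sph_le x y)).2]

/-! ### Averaging over the tangential directions -/

/-- An isometry fixing `x` preserves both the measure and `⟨x, y⟩`, so any weight depending on `⟨x,
y⟩` alone passes through the change of variables. -/
theorem integral_comp_sphMap_mul {d : ℕ} {x : Sph d}
    {L : EuclideanSpace ℝ (Fin (d + 1)) ≃ₗᵢ[ℝ] EuclideanSpace ℝ (Fin (d + 1))} (hL : L x = x)
    (w : ℝ → ℝ) (G : Sph d → ℝ) :
    ∫ y, G (sphMap L y) * w (inner ℝ (x : EuclideanSpace ℝ (Fin (d + 1))) y) ∂uniformSph d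
      = ∫ y, G y * w (inner ℝ (x : EuclideanSpace ℝ (Fin (d + 1))) y) ∂uniformSph d := by
  rw [← integral_comp_sphMap L fun y =>
    G y * w (inner ℝ (x : EuclideanSpace ℝ (Fin (d + 1))) y)]
  congr with y
  have : inner ℝ (x : EuclideanSpace ℝ (Fin (d + 1))) (sphMap L y : EuclideanSpace ℝ (Fin (d + 1)))
      = inner ℝ (x : EuclideanSpace ℝ (Fin (d + 1))) y := by
    conv_lhs => rw [← hL]
    exact L.inner_map_map _ _
  rw [this]

theorem logComp_sphMap {d : ℕ} {x : Sph d}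
    {L : EuclideanSpace ℝ (Fin (d + 1)) ≃ₗᵢ[ℝ] EuclideanSpace ℝ (Fin (d + 1))} (hL : L x = x)
    (θ : EuclideanSpace ℝ (Fin (d + 1))) (y : Sph d) :
    logComp x θ (sphMap L y) = logComp x (L.symm θ) y := by
  have : inner ℝ (x : EuclideanSpace ℝ (Fin (d + 1))) (sphMap L y : EuclideanSpace ℝ (Fin (d + 1)))
      = inner ℝ (x : EuclideanSpace ℝ (Fin (d + 1))) y := by
    conv_lhs => rw [← hL]
    exact L.inner_map_map _ _
  rw [logComp, logComp, this]
  congr 1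
  conv_lhs => rw [← L.apply_symm_apply θ]
  exact L.inner_map_map _ _

theorem reflection_fix {d : ℕ} {x : Sph d} {u : EuclideanSpace ℝ (Fin (d + 1))}
    (hu : inner ℝ (x : EuclideanSpace ℝ (Fin (d + 1))) u = 0) :
    (Submodule.span ℝ {u})ᗮ.reflection (x : EuclideanSpace ℝ (Fin (d + 1))) = x := by
  apply Submodule.reflection_mem_subspace_eq_self
  rw [Submodule.mem_orthogonal_singleton_iff_inner_right, real_inner_comm]
  exact hu

/-- For tangent vectors of equal length, the reflection in the hyperplane orthogonal to `η - θ`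
exchanges them and fixes `x`. This isotropy determines all the moments below. -/
theorem integral_logComp_pow_eq {d : ℕ} {x : Sph d} {θ η : EuclideanSpace ℝ (Fin (d + 1))}
    (hθ : inner ℝ (x : EuclideanSpace ℝ (Fin (d + 1))) θ = 0)
    (hη : inner ℝ (x : EuclideanSpace ℝ (Fin (d + 1))) η = 0) (h : ‖θ‖ = ‖η‖) (w : ℝ → ℝ) (k : ℕ) :
    ∫ y, logComp x θ y ^ k * w (inner ℝ (x : EuclideanSpace ℝ (Fin (d + 1))) y) ∂uniformSph d
      = ∫ y, logComp x η y ^ k * w (inner ℝ (x : EuclideanSpace ℝ (Fin (d + 1))) y)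
        ∂uniformSph d := by
  have hfix := reflection_fix (x := x) (u := η - θ) (by rw [inner_sub_right, hθ, hη, sub_zero])
  rw [← integral_comp_sphMap_mul hfix]
  congr with y
  rw [logComp_sphMap hfix, Submodule.reflection_symm]
  congr 3
  exact (congrArg _ (Submodule.reflection_sub h.symm).symm).trans
    (Submodule.reflection_reflection _ _)

/-- Products with a single factor along `u`, the other factors being orthogonal to `u`, have vanishing
average. -/
theorem integral_logComp_mul_eq_zero {d : ℕ} {x : Sph d} {u : EuclideanSpace ℝ (Fin (d + 1))}
    (hu : inner ℝ (x : EuclideanSpace ℝ (Fin (d + 1))) u = 0) {ι : Type*} (s : Finset ι)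
    (θ : ι → EuclideanSpace ℝ (Fin (d + 1))) (hθ : ∀ i ∈ s, inner ℝ u (θ i) = 0) (w : ℝ → ℝ) :
    ∫ y, (logComp x u y * ∏ i ∈ s, logComp x (θ i) y) *
      w (inner ℝ (x : EuclideanSpace ℝ (Fin (d + 1))) y) ∂uniformSph d = 0 := by
  have hfix := reflection_fix hu
  have h := integral_comp_sphMap_mul hfix w fun y => logComp x u y * ∏ i ∈ s, logComp x (θ i) y
  have h2 : ∀ y, logComp x u (sphMap (Submodule.span ℝ {u})ᗮ.reflection y) = - logComp x u y := by
    intro y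
    rw [logComp_sphMap hfix, Submodule.reflection_symm,
      Submodule.reflection_orthogonalComplement_singleton_eq_neg]
    simp [logComp]
  have h3 : ∀ y, ∏ i ∈ s, logComp x (θ i) (sphMap (Submodule.span ℝ {u})ᗮ.reflection y)
      = ∏ i ∈ s, logComp x (θ i) y := by
    intro y
    refine Finset.prod_congr rfl fun i hi => ?_
    rw [logComp_sphMap hfix, Submodule.reflection_symm, Submodule.reflection_mem_subspace_eq_self]
    exact Submodule.mem_orthogonal_singleton_iff_inner_right.2 (hθ i hi)
  simp only [h2, h3, neg_mul, integral_neg] at h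
  linarith

/-- Functions that are odd in the normal coordinates have vanishing average. -/
theorem integral_odd_eq_zero {d : ℕ} {x : Sph d} (b : OrthonormalBasis (Fin d) ℝ (Tan x))
    {G : EuclideanSpace ℝ (Fin d) → ℝ} (hG : ∀ v, G (-v) = -G v) (w : ℝ → ℝ) :
    ∫ y, G (logCoord x b y) * w (inner ℝ (x : EuclideanSpace ℝ (Fin (d + 1))) y) ∂uniformSph d
      = 0 := by
  -- The reflection through the line of `x` fixes `x` and acts as `-1` on the tangent space, so it
  -- negates the normal coordinates.
  have hfix : (Submodule.span ℝ {(x : EuclideanSpace ℝ (Fin (d + 1)))}).reflection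
      (x : EuclideanSpace ℝ (Fin (d + 1))) = x :=
    Submodule.reflection_mem_subspace_eq_self (Submodule.mem_span_singleton_self _)
  have h := integral_comp_sphMap_mul hfix w fun y => G (logCoord x b y)
  have h2 : ∀ y, logCoord x b (sphMap (Submodule.span ℝ
      {(x : EuclideanSpace ℝ (Fin (d + 1)))}).reflection y) = - logCoord x b y := by
    intro y
    ext i
    simp only [logCoord, PiLp.neg_apply]
    rw [logComp_sphMap hfix, Submodule.reflection_symm,
      Submodule.reflection_mem_subspace_orthogonalComplement_eq_neg (b i).2]
    simp [logComp]
  simp only [h2, hG, neg_mul, integral_neg] at h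
  linarith

theorem measurable_logCoord {d : ℕ} (x : Sph d) (b : OrthonormalBasis (Fin d) ℝ (Tan x)) :
    Measurable (logCoord x b) := by
  refine (WithLp.measurable_toLp 2 _).comp (measurable_pi_iff.2 fun i => ?_)
  unfold logComp
  have h1 : Continuous fun y : Sph d => Real.sinc (Real.arccos (inner ℝ
      (x : EuclideanSpace ℝ (Fin (d + 1))) (y : EuclideanSpace ℝ (Fin (d + 1))))) :=
    Real.continuous_sinc.comp (Real.continuous_arccos.comp (by fun_prop))
  have h2 : Continuous fun y : Sph d => inner ℝ
      (b i : EuclideanSpace ℝ (Fin (d + 1))) (y : EuclideanSpace ℝ (Fin (d + 1))) := by fun_prop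
  exact h1.measurable.inv.mul h2.measurable

theorem integrable_comp_logCoord_mul {d : ℕ} (x : Sph d) (b : OrthonormalBasis (Fin d) ℝ (Tan x))
    {G : EuclideanSpace ℝ (Fin d) → ℝ} (hG : Continuous G) {w : ℝ → ℝ} (hw : Measurable w)
    (hw0 : ∀ t ≤ 0, w t = 0) {C : ℝ} (hwC : ∀ t ≤ 1, |w t| ≤ C) :
    Integrable (fun y => G (logCoord x b y) *
      w (inner ℝ (x : EuclideanSpace ℝ (Fin (d + 1))) y)) (uniformSph d) := by
  -- Where the weight does not vanish, the normal coordinates have norm at most `π ≤ 4`.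
  obtain ⟨K, hK⟩ := (isCompact_closedBall (0 : EuclideanSpace ℝ (Fin d)) 4).bddAbove_image
    hG.norm.continuousOn
  have hC : 0 ≤ C := (abs_nonneg _).trans (hwC 0 zero_le_one)
  refine Integrable.of_bound (C := |K| * C) ?_ (Eventually.of_forall fun y => ?_)
  · refine ((hG.measurable.comp (measurable_logCoord x b)).mul
      (hw.comp ?_)).aestronglyMeasurable
    exact (by fun_prop : Continuous fun y : Sph d => inner ℝ
      (x : EuclideanSpace ℝ (Fin (d + 1))) (y : EuclideanSpace ℝ (Fin (d + 1)))).measurable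
  · rw [norm_mul]
    rcases le_or_gt (inner ℝ (x : EuclideanSpace ℝ (Fin (d + 1)))
      (y : EuclideanSpace ℝ (Fin (d + 1)))) 0 with h | h
    · rw [hw0 _ h, norm_zero, mul_zero]
      positivity
    · have h1 : ‖G (logCoord x b y)‖ ≤ K := by
        refine hK ⟨_, ?_, rfl⟩
        rw [mem_closedBall_zero_iff, norm_logCoord x b h]
        exact (Real.arccos_le_pi _).trans Real.pi_le_four
      refine mul_le_mul (h1.trans (le_abs_self K)) (hwC _ (abs_le.1 (abs_inner_sph_le x y)).2)
        (norm_nonneg _) (abs_nonneg _)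

/-! ### Isotropic moments of order two and four -/

section Moments

variable {d : ℕ} (x : Sph d) (b : OrthonormalBasis (Fin d) ℝ (Tan x)) (w : ℝ → ℝ)

/-- The weighted integral over the sphere of a function of the normal coordinates. -/
def avg (G : EuclideanSpace ℝ (Fin d) → ℝ) : ℝ :=
  ∫ y, G (logCoord x b y) * w (inner ℝ (x : EuclideanSpace ℝ (Fin (d + 1))) y) ∂uniformSph d

/-- An admissible weight: measurable, bounded and supported in the open hemisphere around `x`. -/
structure IsWeight (w : ℝ → ℝ) : Prop where
  measurable : Measurable w
  eq_zero : ∀ t ≤ 0, w t = 0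
  bounded : ∃ C, ∀ t ≤ 1, |w t| ≤ C

variable {w}

theorem IsWeight.integrable (hw : IsWeight w) {G : EuclideanSpace ℝ (Fin d) → ℝ}
    (hG : Continuous G) : Integrable (fun y => G (logCoord x b y) *
      w (inner ℝ (x : EuclideanSpace ℝ (Fin (d + 1))) y)) (uniformSph d) := by
  obtain ⟨C, hC⟩ := hw.bounded
  exact integrable_comp_logCoord_mul x b hG hw.measurable hw.eq_zero hC

theorem avg_add (hw : IsWeight w) {G H : EuclideanSpace ℝ (Fin d) → ℝ} (hG : Continuous G)
    (hH : Continuous H) : avg x b w (fun v => G v + H v) = avg x b w G + avg x b w H := by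
  simp only [avg, add_mul]
  exact integral_add (hw.integrable x b hG) (hw.integrable x b hH)

theorem avg_sub (hw : IsWeight w) {G H : EuclideanSpace ℝ (Fin d) → ℝ} (hG : Continuous G)
    (hH : Continuous H) : avg x b w (fun v => G v - H v) = avg x b w G - avg x b w H := by
  simp only [avg, sub_mul]
  exact integral_sub (hw.integrable x b hG) (hw.integrable x b hH)

theorem avg_sum (hw : IsWeight w) {ι : Type*} (s : Finset ι)
    {G : ι → EuclideanSpace ℝ (Fin d) → ℝ} (hG : ∀ i, Continuous (G i)) :
    avg x b w (fun v => ∑ i ∈ s, G i v) = ∑ i ∈ s, avg x b w (G i) := by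
  simp only [avg, Finset.sum_mul]
  exact integral_finsetSum _ fun i _ => hw.integrable x b (hG i)

theorem avg_const_mul (c : ℝ) (G : EuclideanSpace ℝ (Fin d) → ℝ) :
    avg x b w (fun v => c * G v) = c * avg x b w G := by
  simp only [avg, mul_assoc]
  exact integral_const_mul _ _

theorem inner_basis_basis (i j : Fin d) : inner ℝ (b i : EuclideanSpace ℝ (Fin (d + 1)))
    (b j : EuclideanSpace ℝ (Fin (d + 1))) = if i = j then 1 else 0 := by
  rw [← Submodule.coe_inner]
  exact orthonormal_iff_ite.1 b.orthonormal i j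

theorem avg_two_of_ne {i j : Fin d} (h : i ≠ j) : avg x b w (fun v => v i * v j) = 0 := by
  have := integral_logComp_mul_eq_zero (inner_tan (b i)) {j}
    (fun j => (b j : EuclideanSpace ℝ (Fin (d + 1)))) (by simp [inner_basis_basis, h]) w
  simpa [avg, logCoord] using this

theorem avg_four_of_ne {i j k l : Fin d} (hj : i ≠ j) (hk : i ≠ k) (hl : i ≠ l) :
    avg x b w (fun v => v i * v j * v k * v l) = 0 := by
  have := integral_logComp_mul_eq_zero (inner_tan (b i)) Finset.univ
    (fun a => (b (![j, k, l] a) : EuclideanSpace ℝ (Fin (d + 1))))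
    (by
      intro a _
      rw [inner_basis_basis, if_neg]
      fin_cases a <;> simpa) w
  simpa [avg, logCoord, Fin.prod_univ_three, mul_assoc] using this

theorem avg_pow_eq (k : ℕ) (i j : Fin d) :
    avg x b w (fun v => v i ^ k) = avg x b w (fun v => v j ^ k) := by
  have h : ‖(b i : EuclideanSpace ℝ (Fin (d + 1)))‖ = ‖(b j : EuclideanSpace ℝ (Fin (d + 1)))‖ := by
    rw [Submodule.norm_coe, Submodule.norm_coe, b.norm_eq_one, b.norm_eq_one]
  exact integral_logComp_pow_eq (inner_tan (b i)) (inner_tan (b j)) h w k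

theorem avg_two (hw : IsWeight w) (i : Fin d) :
    avg x b w (fun v => v i * v i) = avg x b w (fun v => ‖v‖ ^ 2) / d := by
  have hd : (d : ℝ) ≠ 0 := by
    have := i.pos
    positivity
  have h1 : (fun v : EuclideanSpace ℝ (Fin d) => ‖v‖ ^ 2) = fun v => ∑ j, v j ^ 2 := by
    ext v
    rw [EuclideanSpace.real_norm_sq_eq]
  rw [h1, avg_sum x b hw _ (by fun_prop), Finset.sum_congr rfl fun j _ => avg_pow_eq x b 2 j i]
  simp [← pow_two]
  field_simp

/-- `b i + c • b j` has length `√2`, so its fourth moment is that of `√2 • b i`. -/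
theorem avg_add_pow_four {i j : Fin d} (h : i ≠ j) (c : ℝ) (hc : c ^ 2 = 1) :
    avg x b w (fun v => (v i + c * v j) ^ 4) = 4 * avg x b w (fun v => v i ^ 4) := by
  have h1 : ‖(b i : EuclideanSpace ℝ (Fin (d + 1))) + c • (b j : EuclideanSpace ℝ (Fin (d + 1)))‖
      = ‖√2 • (b i : EuclideanSpace ℝ (Fin (d + 1)))‖ := by
    rw [← sq_eq_sq₀ (norm_nonneg _) (norm_nonneg _), norm_add_sq_real, inner_smul_right,
      inner_basis_basis, if_neg h, norm_smul, norm_smul, mul_pow, mul_pow]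
    simp only [Submodule.norm_coe, OrthonormalBasis.norm_eq_one, Real.norm_eq_abs, sq_abs, hc]
    norm_num
  have h2 := integral_logComp_pow_eq
    (by rw [inner_add_right, inner_smul_right, inner_tan, inner_tan]; simp)
    (by rw [inner_smul_right, inner_tan]; simp) h1 w 4
  have h3 : ∀ y, logComp x (√2 • (b i : EuclideanSpace ℝ (Fin (d + 1)))) y ^ 4
      = 4 * logComp x (b i : EuclideanSpace ℝ (Fin (d + 1))) y ^ 4 := by
    intro y
    have : √2 ^ 4 = 4 := by
      rw [show (4 : ℕ) = 2 * 2 by norm_num, pow_mul, Real.sq_sqrt (by norm_num)]; norm_num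
    simp only [logComp, inner_smul_left, RCLike.conj_to_real]
    rw [← this]; ring
  have h4 : ∀ y, logComp x ((b i : EuclideanSpace ℝ (Fin (d + 1))) +
      c • (b j : EuclideanSpace ℝ (Fin (d + 1)))) y =
      logComp x (b i : EuclideanSpace ℝ (Fin (d + 1))) y +
        c * logComp x (b j : EuclideanSpace ℝ (Fin (d + 1))) y := by
    intro y
    simp only [logComp, inner_add_left, inner_smul_left, RCLike.conj_to_real]
    ring
  simp only [h3, h4] at h2
  rw [← avg_const_mul]
  exact h2

/-- Adding the fourth moments of `v i + v j` and `v i - v j` cancels the odd cross terms; with `m`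
and `q` the pure and mixed moments, `8 m = 4 m + 12 q`. -/
theorem avg_two_two (hw : IsWeight w) {i j : Fin d} (h : i ≠ j) :
    avg x b w (fun v => v i ^ 2 * v j ^ 2) = avg x b w (fun v => v i ^ 4) / 3 := by
  have h1 := avg_add_pow_four x b (w := w) h 1 (by norm_num)
  have h2 := avg_add_pow_four x b (w := w) h (-1) (by norm_num)
  have h3 : avg x b w (fun v => (v i + 1 * v j) ^ 4) + avg x b w (fun v => (v i + -1 * v j) ^ 4)
      = 2 * avg x b w (fun v => v i ^ 4) + (12 * avg x b w (fun v => v i ^ 2 * v j ^ 2)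
        + 2 * avg x b w (fun v => v j ^ 4)) := by
    rw [← avg_add x b hw (by fun_prop) (by fun_prop), ← avg_const_mul, ← avg_const_mul,
      ← avg_const_mul, ← avg_add x b hw (by fun_prop) (by fun_prop),
      ← avg_add x b hw (by fun_prop) (by fun_prop)]
    congr with v
    ring
  rw [avg_pow_eq x b 4 j i] at h3
  linarith

/-- Expanding `‖v‖ ^ 4` gives `d` pure and `d (d - 1)` mixed moments, the mixed ones being a third
of the pure ones. -/
theorem avg_four_self (hw : IsWeight w) (i : Fin d) :
    avg x b w (fun v => v i ^ 4) = 3 * avg x b w (fun v => ‖v‖ ^ 4) / (d * (d + 2)) := by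
  have hd : (d : ℝ) ≠ 0 := by
    have := i.pos
    positivity
  have h1 : (fun v : EuclideanSpace ℝ (Fin d) => ‖v‖ ^ 4)
      = fun v => ∑ j, ∑ k, v j ^ 2 * v k ^ 2 := by
    ext v
    rw [show (4 : ℕ) = 2 * 2 by norm_num, pow_mul, EuclideanSpace.real_norm_sq_eq, sq,
      Finset.sum_mul_sum]
  have h2 : ∀ j k : Fin d, avg x b w (fun v => v j ^ 2 * v k ^ 2) =
      avg x b w (fun v => v i ^ 4) / 3 +
        if j = k then 2 * avg x b w (fun v => v i ^ 4) / 3 else 0 := by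
    intro j k
    split_ifs with hjk
    · subst hjk
      simp only [← pow_add]
      rw [avg_pow_eq x b 4 i j]
      ring
    · rw [avg_two_two x b hw hjk, avg_pow_eq x b 4 i j, add_zero]
  rw [h1, avg_sum x b hw _ (by fun_prop),
    Finset.sum_congr rfl fun j _ => avg_sum x b hw _ (by fun_prop)]
  simp only [h2, Finset.sum_add_distrib, Finset.sum_ite_eq, Finset.mem_univ, if_true,
    Finset.sum_const, Finset.card_univ, Fintype.card_fin, nsmul_eq_mul]
  have : (d : ℝ) + 2 ≠ 0 := by positivity
  field_simp

/-- Wick's formula: a sum over the three pairings of the indices. An index occurring only once kills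
the average, and on the full diagonal the three pairings give the factor 3. -/
theorem avg_four (hw : IsWeight w) (i j k l : Fin d) :
    avg x b w (fun v => v i * v j * v k * v l) =
      avg x b w (fun v => ‖v‖ ^ 4) / (d * (d + 2)) *
        ((if i = j ∧ k = l then 1 else 0) + (if i = k ∧ j = l then 1 else 0) +
          (if i = l ∧ j = k then 1 else 0)) := by
  set B := avg x b w (fun v => ‖v‖ ^ 4) / (d * (d + 2)) with hB
  have hself : ∀ i, avg x b w (fun v => v i * v i * v i * v i) = 3 * B := by
    intro i
    rw [hB, ← mul_div_assoc, ← avg_four_self x b hw i]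
    congr with v; ring
  have hpair : ∀ i j, i ≠ j → avg x b w (fun v => v i * v i * v j * v j) = B := by
    intro i j hij
    have : avg x b w (fun v => v i * v i * v j * v j) = avg x b w (fun v => v i ^ 2 * v j ^ 2) := by
      congr with v; ring
    rw [this, avg_two_two x b hw hij, avg_four_self x b hw i, hB]
    ring
  have hswap : ∀ i j k l, avg x b w (fun v => v i * v j * v k * v l)
      = avg x b w (fun v => v j * v i * v k * v l) := by
    intro i j k l; congr with v; ring
  have hswap2 : ∀ i j k l, avg x b w (fun v => v i * v j * v k * v l)
      = avg x b w (fun v => v i * v k * v j * v l) := by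
    intro i j k l; congr with v; ring
  have hswap3 : ∀ i j k l, avg x b w (fun v => v i * v j * v k * v l)
      = avg x b w (fun v => v i * v j * v l * v k) := by
    intro i j k l; congr with v; ring
  have main : ∀ i k l, avg x b w (fun v => v i * v i * v k * v l) =
      B * ((if k = l then 1 else 0) + (if i = k ∧ i = l then 1 else 0) +
          (if i = l ∧ i = k then 1 else 0)) := by
    intro i k l
    by_cases hkl : k = l
    · subst hkl
      by_cases hik : i = k
      · subst hik
        rw [hself]; simp; ring
      · rw [hpair i k hik]; simp [hik]
    · have : ¬ (i = k ∧ i = l) := fun h => hkl (h.1.symm.trans h.2)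
      have h' : ¬ (i = l ∧ i = k) := fun h => hkl (h.2.symm.trans h.1)
      simp only [hkl, this, h', if_false, add_zero, mul_zero]
      by_cases hik : i = k
      · have hil : l ≠ i := fun h => hkl (hik.symm.trans h.symm)
        rw [hswap3, hswap2, hswap]
        exact avg_four_of_ne x b hil hil (fun h => hkl h.symm)
      · rw [hswap2, hswap]
        exact avg_four_of_ne x b (Ne.symm hik) (Ne.symm hik) hkl
  by_cases hij : i = j
  · subst hij
    rw [main]; simp
  by_cases hik : i = k
  · subst hik
    rw [hswap2, main]
    simp [hij, Ne.symm hij]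
  by_cases hil : i = l
  · subst hil
    rw [hswap3, hswap2, main]
    simp [hij, hik]
  rw [avg_four_of_ne x b hij hik hil]
  simp [hij, hik, hil]

end Moments

/-! ### Averages of homogeneous polynomials -/

theorem sum_fin_succ_fun {ι M : Type*} [Fintype ι] [DecidableEq ι] [AddCommMonoid M] {n : ℕ}
    (F : (Fin (n + 1) → ι) → M) :
    ∑ r, F r = ∑ i, ∑ r : Fin n → ι, F (Matrix.vecCons i r) := by
  rw [← (Fin.consEquiv fun _ : Fin (n + 1) => ι).sum_comp, Fintype.sum_prod_type]
  rfl

theorem multilinear_diag_eq_sum {d n : ℕ}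
    (D : ContinuousMultilinearMap ℝ (fun _ : Fin n => EuclideanSpace ℝ (Fin d)) ℝ)
    (v : EuclideanSpace ℝ (Fin d)) :
    (D fun _ => v) = ∑ r : Fin n → Fin d, (∏ a, v (r a)) * D fun a => EuclideanSpace.single (r a) 1 := by
  have hv : v = ∑ i, v i • EuclideanSpace.single i (1 : ℝ) := by
    conv_lhs => rw [← (EuclideanSpace.basisFun (Fin d) ℝ).sum_repr v]
    simp
  conv_lhs => rw [hv]
  rw [ContinuousMultilinearMap.map_sum]
  refine Finset.sum_congr rfl fun r _ => ?_
  rw [ContinuousMultilinearMap.map_smul_univ, smul_eq_mul]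

section

variable {d : ℕ} (x : Sph d) (b : OrthonormalBasis (Fin d) ℝ (Tan x)) {w : ℝ → ℝ}

theorem avg_diag_two (hw : IsWeight w)
    (D : ContinuousMultilinearMap ℝ (fun _ : Fin 2 => EuclideanSpace ℝ (Fin d)) ℝ) :
    avg x b w (fun v => D fun _ => v) =
      (∑ i, D ![EuclideanSpace.single i 1, EuclideanSpace.single i 1]) / d
        * avg x b w (fun v => ‖v‖ ^ 2) := by
  have h1 : (fun v : EuclideanSpace ℝ (Fin d) => D fun _ => v) = fun v => ∑ i, ∑ j,
      D ![EuclideanSpace.single i 1, EuclideanSpace.single j 1] * (v i * v j) := by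
    ext v
    rw [multilinear_diag_eq_sum, sum_fin_succ_fun]
    refine Finset.sum_congr rfl fun i _ => ?_
    rw [sum_fin_succ_fun]
    refine Finset.sum_congr rfl fun j _ => ?_
    rw [Fintype.sum_unique, mul_comm]
    congr 1
    · congr 1
      ext a : 1
      fin_cases a <;> rfl
    · simp [Fin.prod_univ_two]
  rw [h1, avg_sum x b hw _ (by fun_prop),
    Finset.sum_congr rfl fun i _ => avg_sum x b hw _ (by fun_prop)]
  simp only [avg_const_mul]
  rw [Finset.sum_div, Finset.sum_mul]
  refine Finset.sum_congr rfl fun i _ => ?_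
  rw [Finset.sum_eq_single i, avg_two x b hw]
  · ring
  · intro j _ hj
    rw [avg_two_of_ne x b (Ne.symm hj), mul_zero]
  · simp

/-- The two transposition hypotheses are just what makes the three pairings contribute the same
double trace. -/
theorem avg_diag_four (hw : IsWeight w)
    (D : ContinuousMultilinearMap ℝ (fun _ : Fin 4 => EuclideanSpace ℝ (Fin d)) ℝ)
    (h12 : ∀ a b c e, D ![a, b, c, e] = D ![a, c, b, e])
    (h23 : ∀ a b c e, D ![a, b, c, e] = D ![a, b, e, c]) :
    avg x b w (fun v => D fun _ => v) =
      3 * (∑ i, ∑ j, D ![EuclideanSpace.single i 1, EuclideanSpace.single i 1,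
        EuclideanSpace.single j 1, EuclideanSpace.single j 1]) / (d * (d + 2))
        * avg x b w (fun v => ‖v‖ ^ 4) := by
  have h1 : (fun v : EuclideanSpace ℝ (Fin d) => D fun _ => v) = fun v => ∑ i, ∑ j, ∑ k, ∑ l,
      D ![EuclideanSpace.single i 1, EuclideanSpace.single j 1, EuclideanSpace.single k 1,
        EuclideanSpace.single l 1] * (v i * v j * v k * v l) := by
    ext v
    rw [multilinear_diag_eq_sum, sum_fin_succ_fun]
    refine Finset.sum_congr rfl fun i _ => ?_
    rw [sum_fin_succ_fun]
    refine Finset.sum_congr rfl fun j _ => ?_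
    rw [sum_fin_succ_fun]
    refine Finset.sum_congr rfl fun k _ => ?_
    rw [sum_fin_succ_fun]
    refine Finset.sum_congr rfl fun l _ => ?_
    rw [Fintype.sum_unique, mul_comm]
    congr 1
    · congr 1
      ext a : 1
      fin_cases a <;> rfl
    · simp [Fin.prod_univ_four]
  rw [h1, avg_sum x b hw _ (by fun_prop),
    Finset.sum_congr rfl fun i _ => avg_sum x b hw _ (by fun_prop),
    Finset.sum_congr rfl fun i _ => Finset.sum_congr rfl fun j _ => avg_sum x b hw _ (by fun_prop),
    Finset.sum_congr rfl fun i _ => Finset.sum_congr rfl fun j _ => Finset.sum_congr rfl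
      fun k _ => avg_sum x b hw _ (by fun_prop)]
  simp only [avg_const_mul, avg_four x b hw]
  set B := avg x b w (fun v => ‖v‖ ^ 4) / (d * (d + 2)) with hB
  have hR : 3 * (∑ i : Fin d, ∑ j : Fin d, D ![EuclideanSpace.single i 1, EuclideanSpace.single i 1,
        EuclideanSpace.single j 1, EuclideanSpace.single j 1]) / (d * (d + 2))
        * avg x b w (fun v => ‖v‖ ^ 4) =
      3 * ((∑ i : Fin d, ∑ j : Fin d, D ![EuclideanSpace.single i 1, EuclideanSpace.single i 1,
        EuclideanSpace.single j 1, EuclideanSpace.single j 1]) * B) := by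
    rw [hB]; ring
  have e2 : ∀ i j : Fin d, D ![EuclideanSpace.single i 1, EuclideanSpace.single j 1,
      EuclideanSpace.single i 1, EuclideanSpace.single j 1] =
      D ![EuclideanSpace.single i 1, EuclideanSpace.single i 1,
        EuclideanSpace.single j 1, EuclideanSpace.single j 1] := fun i j => h12 _ _ _ _
  have e3 : ∀ i j : Fin d, D ![EuclideanSpace.single i 1, EuclideanSpace.single j 1,
      EuclideanSpace.single j 1, EuclideanSpace.single i 1] =
      D ![EuclideanSpace.single i 1, EuclideanSpace.single i 1,
        EuclideanSpace.single j 1, EuclideanSpace.single j 1] := fun i j =>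
    (h23 _ _ _ _).trans (e2 i j)
  rw [hR]
  simp only [mul_add, Finset.sum_add_distrib, mul_ite, mul_one, mul_zero, ite_and]
  simp only [Finset.sum_ite_irrel, Finset.sum_const_zero, Finset.sum_ite_eq, Finset.mem_univ,
    if_true, e2, e3, ← Finset.sum_mul]
  ring

end

/-! ### Symmetry of the fourth derivative -/

/-- Moves a symmetry to inner slots. The equality must hold at every point, because the new first
slot differentiates in it. -/
theorem iteratedFDeriv_cons_congr {V : Type*} [NormedAddCommGroup V] [NormedSpace ℝ V]
    {g : V → ℝ} {n : ℕ∞ω} {k : ℕ} (hg : ContDiff ℝ n g) (hk : (k + 1 : ℕ) ≤ n) {v v' : Fin k → V}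
    (h : ∀ y, iteratedFDeriv ℝ k g y v = iteratedFDeriv ℝ k g y v') (x a : V) :
    iteratedFDeriv ℝ (k + 1) g x (Matrix.vecCons a v) =
      iteratedFDeriv ℝ (k + 1) g x (Matrix.vecCons a v') := by
  have h1 : DifferentiableAt ℝ (iteratedFDeriv ℝ k g) x :=
    (hg.differentiable_iteratedFDeriv (lt_of_lt_of_le (by norm_cast; omega) hk)) x
  have key : ∀ u : Fin k → V, iteratedFDeriv ℝ (k + 1) g x (Matrix.vecCons a u) =
      fderiv ℝ (fun y => iteratedFDeriv ℝ k g y u) x a := by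
    intro u
    rw [(h1.hasFDerivAt.continuousMultilinear_apply_const u).fderiv, iteratedFDeriv_succ_apply_left]
    rfl
  rw [key, key]
  simp only [h]

theorem iteratedFDeriv_four_swap_one_two {V : Type*} [NormedAddCommGroup V] [NormedSpace ℝ V]
    {g : V → ℝ} {n : ℕ∞ω} (hg : ContDiff ℝ n g) (hn : (4 : ℕ) ≤ n) (x a b c e : V) :
    iteratedFDeriv ℝ 4 g x ![a, b, c, e] = iteratedFDeriv ℝ 4 g x ![a, c, b, e] :=
  iteratedFDeriv_cons_congr hg hn (fun y => iteratedFDeriv_swap_zero_one (k := 1) hg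
    (le_trans (by norm_cast) hn) y b c ![e]) x a

theorem iteratedFDeriv_four_swap_two_three {V : Type*} [NormedAddCommGroup V] [NormedSpace ℝ V]
    {g : V → ℝ} {n : ℕ∞ω} (hg : ContDiff ℝ n g) (hn : (4 : ℕ) ≤ n) (x a b c e : V) :
    iteratedFDeriv ℝ 4 g x ![a, b, c, e] = iteratedFDeriv ℝ 4 g x ![a, b, e, c] :=
  iteratedFDeriv_cons_congr hg hn (fun y => iteratedFDeriv_cons_congr (k := 2) hg
    (le_trans (by norm_cast) hn) (fun z => iteratedFDeriv_swap_zero_one (k := 0) hg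
      (le_trans (by norm_cast) hn) z c e ![]) y b) x a

/-! ### The operator on the sphere -/

theorem setIntegral_nbhd_comp_sphMap {d : ℕ} {x : Sph d}
    {L : EuclideanSpace ℝ (Fin (d + 1)) ≃ₗᵢ[ℝ] EuclideanSpace ℝ (Fin (d + 1))} (hL : L x = x)
    {F : Type*} [NormedAddCommGroup F] [NormedSpace ℝ F] (ε : ℝ) (G : Sph d → F) :
    ∫ y in nbhd (incl d) ε x, G (sphMap L y) ∂uniformSph d
      = ∫ y in nbhd (incl d) ε x, G y ∂uniformSph d := by
  rw [← integral_indicator (measurableSet_nbhd x ε), ← integral_indicator (measurableSet_nbhd x ε),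
    ← integral_comp_sphMap L ((nbhd (incl d) ε x).indicator G)]
  congr with y
  have : sphMap L y ∈ nbhd (incl d) ε x ↔ y ∈ nbhd (incl d) ε x := by
    rw [mem_nbhd_iff_norm, mem_nbhd_iff_norm]
    conv_lhs => rw [← hL]
    simp only [sphMap]
    rw [← map_sub, L.norm_map]
  by_cases h : y ∈ nbhd (incl d) ε x
  · rw [indicator_of_mem h, indicator_of_mem (this.2 h)]
  · rw [indicator_of_notMem h, indicator_of_notMem (fun h' => h (this.1 h'))]

/-- The moments `𝔼[(1 - ⟨x, X⟩) ^ k χ]`. -/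
def heightMoment {d : ℕ} (x : Sph d) (k : ℕ) (ε : ℝ) : ℝ :=
  ∫ y in nbhd (incl d) ε x, (1 - inner ℝ (x : EuclideanSpace ℝ (Fin (d + 1))) y) ^ k ∂uniformSph d

theorem integrable_of_continuous {d : ℕ} {F : Type*} [NormedAddCommGroup F]
    {G : Sph d → F} (hG : Continuous G) : Integrable G (uniformSph d) :=
  hG.integrable_of_hasCompactSupport (HasCompactSupport.of_compactSpace G)

/-- The reflection through the line of `x` sends `y` to `2 ⟨x, y⟩ x - y`, so averaging `y - x` with
its image leaves `-(1 - ⟨x, y⟩) x`. The case `k = 0` gives the local mean, `k = 1` the image of `x`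
under the covariance. -/
theorem setIntegral_height_pow_smul {d : ℕ} (x : Sph d) (k : ℕ) (ε : ℝ) :
    ∫ y in nbhd (incl d) ε x, (1 - inner ℝ (x : EuclideanSpace ℝ (Fin (d + 1))) y) ^ k •
      ((y : EuclideanSpace ℝ (Fin (d + 1))) - x) ∂uniformSph d
      = -heightMoment x (k + 1) ε • (x : EuclideanSpace ℝ (Fin (d + 1))) := by
  have hfix : (Submodule.span ℝ {(x : EuclideanSpace ℝ (Fin (d + 1)))}).reflection
      (x : EuclideanSpace ℝ (Fin (d + 1))) = x :=
    Submodule.reflection_mem_subspace_eq_self (Submodule.mem_span_singleton_self _)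
  have hcont : Continuous fun y : Sph d => (1 - inner ℝ (x : EuclideanSpace ℝ (Fin (d + 1))) y) ^ k •
      ((y : EuclideanSpace ℝ (Fin (d + 1))) - x) := by fun_prop
  have h := setIntegral_nbhd_comp_sphMap hfix ε fun y =>
    (1 - inner ℝ (x : EuclideanSpace ℝ (Fin (d + 1))) y) ^ k •
      ((y : EuclideanSpace ℝ (Fin (d + 1))) - x)
  have hcont2 : Continuous fun y : Sph d =>
      (1 - inner ℝ (x : EuclideanSpace ℝ (Fin (d + 1))) (sphMap (Submodule.span ℝ
        {(x : EuclideanSpace ℝ (Fin (d + 1)))}).reflection y : EuclideanSpace ℝ (Fin (d + 1)))) ^ k •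
      ((sphMap (Submodule.span ℝ {(x : EuclideanSpace ℝ (Fin (d + 1)))}).reflection y :
        EuclideanSpace ℝ (Fin (d + 1))) - x) := hcont.comp (continuous_sphMap _)
  set I := ∫ y in nbhd (incl d) ε x, (1 - inner ℝ (x : EuclideanSpace ℝ (Fin (d + 1))) y) ^ k •
      ((y : EuclideanSpace ℝ (Fin (d + 1))) - x) ∂uniformSph d with hI
  have h2 : I + I = (2 : ℝ) • (-heightMoment x (k + 1) ε • (x : EuclideanSpace ℝ (Fin (d + 1)))) := by
    nth_rewrite 1 [← h]
    rw [hI, ← integral_add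
      (integrable_of_continuous hcont2).integrableOn
      (integrable_of_continuous hcont).integrableOn, heightMoment, neg_smul, smul_neg,
      ← integral_smul_const, ← integral_smul, ← integral_neg]
    congr with y : 1
    have hrefl : (sphMap (Submodule.span ℝ {(x : EuclideanSpace ℝ (Fin (d + 1)))}).reflection y :
        EuclideanSpace ℝ (Fin (d + 1))) =
        (2 * inner ℝ (x : EuclideanSpace ℝ (Fin (d + 1))) y) • (x : EuclideanSpace ℝ (Fin (d + 1)))
          - y := by
      simp only [sphMap]
      rw [Submodule.reflection_singleton_apply]
      simp
      module
    rw [hrefl, inner_sub_right, inner_smul_right, inner_self_sph]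
    module
  rw [← two_smul ℝ I] at h2
  exact smul_right_injective _ two_ne_zero h2

theorem localMean_sph {d : ℕ} (x : Sph d) (ε : ℝ) :
    localMean (incl d) (uniformSph d) ε x =
      -heightMoment x 1 ε • (x : EuclideanSpace ℝ (Fin (d + 1))) := by
  have := setIntegral_height_pow_smul x 0 ε
  simpa [localMean, incl] using this

theorem localCov_mulVec_sph {d : ℕ} (x : Sph d) (ε : ℝ) :
    (localCov (incl d) (uniformSph d) ε x).mulVec (x : EuclideanSpace ℝ (Fin (d + 1))).ofLp =
      heightMoment x 2 ε • (x : EuclideanSpace ℝ (Fin (d + 1))).ofLp := by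
  have h := setIntegral_height_pow_smul x 1 ε
  ext i
  have hcont : Continuous fun y : Sph d =>
    (1 - inner ℝ (x : EuclideanSpace ℝ (Fin (d + 1))) y) ^ 1 •
      ((y : EuclideanSpace ℝ (Fin (d + 1))) - x) := by fun_prop
  have h2 := congrArg (fun v : EuclideanSpace ℝ (Fin (d + 1)) => EuclideanSpace.proj (𝕜 := ℝ) i v) h
  rw [← ContinuousLinearMap.integral_comp_comm _ (integrable_of_continuous hcont).integrableOn] at h2
  simp only [Matrix.mulVec, dotProduct, localCov, Matrix.of_apply, Pi.smul_apply, smul_eq_mul]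
  have h3 : ∀ j, (∫ y in nbhd (incl d) ε x, (incl d y i - incl d x i) * (incl d y j - incl d x j)
      ∂uniformSph d) * (x : EuclideanSpace ℝ (Fin (d + 1))).ofLp j =
      ∫ y in nbhd (incl d) ε x, (incl d y i - incl d x i) * (incl d y j - incl d x j) *
        (x : EuclideanSpace ℝ (Fin (d + 1))).ofLp j ∂uniformSph d := fun j =>
    (integral_mul_const _ _).symm
  have hc : Continuous (incl d) := continuous_subtype_val
  rw [Finset.sum_congr rfl fun j _ => h3 j, ← integral_finsetSum _
    fun j _ => (integrable_of_continuous (by fun_prop)).integrableOn]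
  have h4 : ∀ y : Sph d, ∑ j, (incl d y i - incl d x i) * (incl d y j - incl d x j) *
        (x : EuclideanSpace ℝ (Fin (d + 1))).ofLp j =
      -((1 - inner ℝ (x : EuclideanSpace ℝ (Fin (d + 1))) y) ^ 1 *
      ((y : EuclideanSpace ℝ (Fin (d + 1))).ofLp i - (x : EuclideanSpace ℝ (Fin (d + 1))).ofLp i)) := by
    intro y
    have h5 : ∑ j, (incl d y j - incl d x j) * (x : EuclideanSpace ℝ (Fin (d + 1))).ofLp j =
        -(1 - inner ℝ (x : EuclideanSpace ℝ (Fin (d + 1))) y) := by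
      have e : -(1 - inner ℝ (x : EuclideanSpace ℝ (Fin (d + 1))) y) =
          inner ℝ (x : EuclideanSpace ℝ (Fin (d + 1)))
            ((y : EuclideanSpace ℝ (Fin (d + 1))) - x) := by
        rw [inner_sub_right, inner_self_sph]; ring
      rw [e, PiLp.inner_apply]
      simp [incl]
    simp only [mul_assoc]
    rw [← Finset.mul_sum, h5]
    simp only [incl]
    ring
  simp only [h4, integral_neg]
  simp at h2 ⊢
  linarith

/-- In the eigenbasis of `C`, an eigenvector for `μ` has nonzero coordinates only where the
eigenvalue is `μ`; neither multiplicities nor the rest of the spectrum matter. Without `μ ≠ 0` the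
vector would be annihilated. -/
theorem regPinv_mulVec {p : ℕ} (c : ℝ) (C : Matrix (Fin p) (Fin p) ℝ) (hC : C.IsHermitian)
    {u : Fin p → ℝ} {μ : ℝ} (hμ : μ ≠ 0) (h : C.mulVec u = μ • u) :
    (regPinv c C hC).mulVec u = (μ + c)⁻¹ • u := by
  set U : Matrix (Fin p) (Fin p) ℝ := (hC.eigenvectorUnitary : Matrix (Fin p) (Fin p) ℝ) with hU
  have hUU : U.transpose * U = 1 := by
    have := Matrix.mem_unitaryGroup_iff'.1 hC.eigenvectorUnitary.2
    simpa [Matrix.star_eq_conjTranspose] using this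
  have hUU' : U * U.transpose = 1 := by
    have := Matrix.mem_unitaryGroup_iff.1 hC.eigenvectorUnitary.2
    simpa [Matrix.star_eq_conjTranspose] using this
  have hspec : C = U * Matrix.diagonal hC.eigenvalues * U.transpose := by
    have := hC.spectral_theorem
    rw [Unitary.conjStarAlgAut_apply] at this
    simpa [Matrix.star_eq_conjTranspose] using this
  set z := U.transpose.mulVec u with hz
  have hz1 : (Matrix.diagonal hC.eigenvalues).mulVec z = μ • z := by
    rw [hz, ← Matrix.mulVec_smul, ← h]
    conv_rhs => rw [hspec]
    simp only [Matrix.mulVec_mulVec, ← Matrix.mul_assoc, hUU, Matrix.one_mul]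
  have hz2 : (Matrix.diagonal (fun i => if hC.eigenvalues i = 0 then 0 else
      (hC.eigenvalues i + c)⁻¹)).mulVec z = (μ + c)⁻¹ • z := by
    ext i
    have := congrFun hz1 i
    simp only [Matrix.mulVec_diagonal, Pi.smul_apply, smul_eq_mul] at this ⊢
    by_cases hi : z i = 0
    · simp [hi]
    · have he := mul_right_cancel₀ hi this
      rw [he, if_neg hμ]
  rw [regPinv, ← hU, ← Matrix.mulVec_mulVec, ← Matrix.mulVec_mulVec, ← hz, hz2,
    Matrix.mulVec_smul, hz, Matrix.mulVec_mulVec, hUU', Matrix.one_mulVec]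

theorem T_sph {d : ℕ} (x : Sph d) {ε : ℝ} (h : heightMoment x 2 ε ≠ 0) :
    T d 8 (incl d) (uniformSph d) ε x =
      -(heightMoment x 1 ε / (heightMoment x 2 ε + ε ^ ((d : ℝ) + 8))) •
        (x : EuclideanSpace ℝ (Fin (d + 1))) := by
  have h2 := regPinv_mulVec (ε ^ ((d : ℝ) + 8)) _ (localCov_isHermitian (incl d) (uniformSph d) ε x)
    h (localCov_mulVec_sph x ε)
  rw [T, localMean_sph, WithLp.ofLp_smul, Matrix.mulVec_smul, h2]
  ext i
  simp
  ring

theorem A_sph {d : ℕ} (x : Sph d) {ε : ℝ} (h : heightMoment x 2 ε ≠ 0) (f : Sph d → ℝ) :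
    A d 8 (incl d) (uniformSph d) ε f x =
      ∫ y in nbhd (incl d) ε x, f y * (1 - heightMoment x 1 ε /
        (heightMoment x 2 ε + ε ^ ((d : ℝ) + 8)) *
          (1 - inner ℝ (x : EuclideanSpace ℝ (Fin (d + 1))) y)) ∂uniformSph d := by
  rw [A, T_sph x h]
  congr with y
  simp only [incl]
  rw [inner_smul_left, inner_sub_right, inner_self_sph]
  simp
  left
  ring

/-! ### Asymptotic calculus as `ε → 0+` -/

/-- `u(ε) = a + O(ε ^ 2)` as `ε → 0+`. -/
def Near (u : ℝ → ℝ) (a : ℝ) : Prop :=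
  (fun ε => u ε - a) =O[𝓝[>] 0] fun ε : ℝ => ε ^ 2

theorem tendsto_pow_nhdsGT_zero {n : ℕ} (hn : n ≠ 0) :
    Tendsto (fun ε : ℝ => ε ^ n) (𝓝[>] 0) (𝓝 0) := by
  have h : Tendsto (fun ε : ℝ => ε ^ n) (𝓝 0) (𝓝 (0 ^ n)) := (continuous_pow n).tendsto 0
  rw [zero_pow hn] at h
  exact h.mono_left nhdsWithin_le_nhds

theorem isBigO_pow_of_le {m n : ℕ} (h : m ≤ n) :
    (fun ε : ℝ => ε ^ n) =O[𝓝[>] 0] fun ε : ℝ => ε ^ m := by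
  refine IsBigO.of_bound 1 ?_
  filter_upwards [Ioo_mem_nhdsGT (zero_lt_one (α := ℝ))] with ε hε
  rw [one_mul, Real.norm_of_nonneg (pow_nonneg hε.1.le _),
    Real.norm_of_nonneg (pow_nonneg hε.1.le _)]
  exact pow_le_pow_of_le_one hε.1.le hε.2.le h

theorem Near.tendsto {u : ℝ → ℝ} {a : ℝ} (h : Near u a) : Tendsto u (𝓝[>] 0) (𝓝 a) := by
  have := h.trans_tendsto (tendsto_pow_nhdsGT_zero two_ne_zero)
  simpa using this.add_const a

theorem Near.isBigO_one {u : ℝ → ℝ} {a : ℝ} (h : Near u a) :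
    u =O[𝓝[>] 0] fun _ => (1 : ℝ) := h.tendsto.isBigO_one ℝ

theorem Near.sub {u v : ℝ → ℝ} {a c : ℝ} (hu : Near u a) (hv : Near v c) :
    Near (fun ε => u ε - v ε) (a - c) := by
  refine (IsBigO.sub hu hv).congr_left fun ε => ?_
  ring

theorem Near.mul {u v : ℝ → ℝ} {a c : ℝ} (hu : Near u a) (hv : Near v c) :
    Near (fun ε => u ε * v ε) (a * c) := by
  have h1 : (fun ε => (u ε - a) * v ε) =O[𝓝[>] 0] fun ε : ℝ => ε ^ 2 * 1 :=
    IsBigO.mul hu hv.isBigO_one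
  have h2 : (fun ε => a * (v ε - c)) =O[𝓝[>] 0] fun ε : ℝ => ε ^ 2 := hv.const_mul_left a
  simp only [mul_one] at h1
  refine (h1.add h2).congr_left fun ε => ?_
  ring

theorem Near.inv {u : ℝ → ℝ} {a : ℝ} (hu : Near u a) (ha : a ≠ 0) :
    Near (fun ε => (u ε)⁻¹) a⁻¹ := by
  have h1 : (fun ε => (u ε)⁻¹ * a⁻¹) =O[𝓝[>] 0] fun _ => (1 : ℝ) :=
    ((hu.tendsto.inv₀ ha).mul_const a⁻¹).isBigO_one ℝ
  have h2 : (fun ε => -((u ε - a) * ((u ε)⁻¹ * a⁻¹))) =O[𝓝[>] 0] fun ε : ℝ => ε ^ 2 * 1 :=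
    (IsBigO.mul hu h1).neg_left
  simp only [mul_one] at h2
  refine h2.congr' ?_ EventuallyEq.rfl
  filter_upwards [hu.tendsto.eventually_ne ha] with ε hε
  field_simp
  ring

theorem Near.div {u v : ℝ → ℝ} {a c : ℝ} (hu : Near u a) (hv : Near v c) (hc : c ≠ 0) :
    Near (fun ε => u ε / v ε) (a / c) := by
  simpa only [div_eq_mul_inv] using hu.mul (hv.inv hc)

/-- The leading coefficient of the `k`-th height moment. -/
def heightCoeff (Z : ℝ) (d k : ℕ) : ℝ := Z * d / ((d + 2 * k) * 2 ^ k)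

/-- The analytic core, free of geometry: `L₂` and `L₄` are the traces of the second and fourth
derivatives, and the `M k` enter only through their leading terms and relative errors `O(ε ^ 2)`. -/
theorem quotient_asymptotics {d m : ℕ} (hd : 0 < d) (hm : m ≤ 6) {Z : ℝ} (hZ : 0 < Z)
    {M : ℕ → ℝ → ℝ} (hM : ∀ k, Near (fun ε => M k ε / ε ^ (d + 2 * k)) (heightCoeff Z d k))
    {κ N : ℝ → ℝ} (hκ : ∀ᶠ ε in 𝓝[>] (0 : ℝ), κ ε = M 1 ε / (M 2 ε + ε ^ (d + 8))) (L₂ L₄ K : ℝ)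
    (hN : ∀ᶠ ε in 𝓝[>] (0 : ℝ),
      |N ε - (L₂ / (2 * d) * (2 * (M 1 ε - κ ε * M 2 ε) + (M 2 ε - κ ε * M 3 ε) / 3) +
        L₄ / (8 * (d * (d + 2))) * (4 * (M 2 ε - κ ε * M 3 ε)))|
        ≤ K * ε ^ m * ((1 + |κ ε| * ε ^ 2) * M 0 ε)) :
    (∀ᶠ ε in 𝓝[>] (0 : ℝ), M 0 ε - κ ε * M 1 ε ≠ 0) ∧
    (fun ε => N ε / (M 0 ε - κ ε * M 1 ε) -
      (-(L₄ / (8 * (d + 4) * (d + 6))) - (d + 2) / (24 * (d + 4) * (d + 6)) * L₂) * ε ^ 4)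
      =O[𝓝[>] 0] fun ε : ℝ => ε ^ m := by
  have hd' : (0 : ℝ) < d := by exact_mod_cast hd
  set u : ℕ → ℝ → ℝ := fun k ε => M k ε / ε ^ (d + 2 * k) with hu
  have hMu : ∀ k, ∀ ε : ℝ, 0 < ε → M k ε = ε ^ (d + 2 * k) * u k ε := by
    intro k ε hε
    simp only [hu]
    rw [mul_div_cancel₀ _ (by positivity)]
  have hpos : ∀ᶠ ε : ℝ in 𝓝[>] 0, 0 < ε := eventually_mem_nhdsWithin
  have h4 : Near (fun ε => u 2 ε + ε ^ 4) (heightCoeff Z d 2) := by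
    refine (IsBigO.add (hM 2) (isBigO_pow_of_le (by norm_num : 2 ≤ 4))).congr_left fun ε => ?_
    ring
  have hc2 : 0 < heightCoeff Z d 2 := by unfold heightCoeff; positivity
  have hκ' : Near (fun ε => u 1 ε / (u 2 ε + ε ^ 4)) (heightCoeff Z d 1 / heightCoeff Z d 2) :=
    (hM 1).div h4 hc2.ne'
  -- `κ` blows up like `ε^(-2)`; `k'` is the rescaling `κ ε ^ 2`, which has a finite limit.
  set k' : ℝ → ℝ := fun ε => u 1 ε / (u 2 ε + ε ^ 4) with hk'
  have hκk : ∀ᶠ ε in 𝓝[>] (0 : ℝ), κ ε * ε ^ 2 = k' ε := by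
    filter_upwards [hκ, hpos] with ε h hε
    rw [h, hMu 1 ε hε, hMu 2 ε hε, hk']
    have e : ε ^ (d + 2 * 2) * u 2 ε + ε ^ (d + 8) = ε ^ (d + 4) * (u 2 ε + ε ^ 4) := by ring
    have e2 : ε ^ (d + 2 * 1) * u 1 ε * ε ^ 2 = ε ^ (d + 4) * u 1 ε := by ring
    rw [e, div_mul_eq_mul_div, e2, mul_div_mul_left _ _ (by positivity)]
  have hD := (hM 0).sub (hκ'.mul (hM 1))
  have hP := (hM 2).sub (hκ'.mul (hM 3))
  set D₀ := heightCoeff Z d 0 - heightCoeff Z d 1 / heightCoeff Z d 2 * heightCoeff Z d 1 with hD₀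
  set P₀ := heightCoeff Z d 2 - heightCoeff Z d 1 / heightCoeff Z d 2 * heightCoeff Z d 3 with hP₀
  have hD₀' : D₀ = 4 * Z / (d + 2) ^ 2 := by
    simp only [hD₀, heightCoeff]
    push_cast
    field_simp
    ring
  have hP₀' : P₀ = -(Z * d / ((d + 2) * (d + 4) * (d + 6))) := by
    simp only [hP₀, heightCoeff]
    push_cast
    field_simp
    ring
  have hD₀pos : 0 < D₀ := by rw [hD₀']; positivity
  have hDM : ∀ᶠ ε in 𝓝[>] (0 : ℝ), M 0 ε - κ ε * M 1 ε = ε ^ d * (u 0 ε - k' ε * u 1 ε) := by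
    filter_upwards [hκk, hpos] with ε h hε
    rw [hMu 0 ε hε, hMu 1 ε hε, ← h]
    ring
  have hPM : ∀ᶠ ε in 𝓝[>] (0 : ℝ),
      M 2 ε - κ ε * M 3 ε = ε ^ (d + 4) * (u 2 ε - k' ε * u 3 ε) := by
    filter_upwards [hκk, hpos] with ε h hε
    rw [hMu 2 ε hε, hMu 3 ε hε, ← h]
    ring
  -- The cancellation of the `ε ^ 2` term. It is the exact identity `M 1 - κ M 2 = κ ε^(d+8)`; the
  -- leading asymptotics of the moments alone would give only `O(ε^(d+4))`.
  have hQM : ∀ᶠ ε in 𝓝[>] (0 : ℝ), M 1 ε - κ ε * M 2 ε = ε ^ (d + 6) * k' ε := by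
    filter_upwards [hκk, hpos, h4.tendsto.eventually_ne hc2.ne'] with ε h hε hne
    have h1 : u 1 ε = k' ε * (u 2 ε + ε ^ 4) := by rw [hk']; field_simp
    have h2 : κ ε * (ε ^ (d + 2 * 2) * u 2 ε) = k' ε * (ε ^ (d + 2) * u 2 ε) := by
      rw [← h]; ring
    rw [hMu 1 ε hε, hMu 2 ε hε, h2]
    conv_lhs => rw [h1]
    ring
  have hDne : ∀ᶠ ε in 𝓝[>] (0 : ℝ), u 0 ε - k' ε * u 1 ε ≠ 0 := hD.tendsto.eventually_ne hD₀pos.ne'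
  refine ⟨?_, ?_⟩
  · filter_upwards [hDM, hDne, hpos] with ε h h1 hε
    rw [h]
    exact mul_ne_zero (by positivity) h1
  -- The total coefficient of `M 2 - κ M 3`: the quartic correction to `r ^ 2` and the fourth-order
  -- Taylor term.
  set γ := L₂ / (6 * d) + L₄ / (2 * (d * (d + 2))) with hγ
  set R : ℝ → ℝ := fun ε => (N ε - (L₂ / (2 * d) * (2 * (M 1 ε - κ ε * M 2 ε) +
    (M 2 ε - κ ε * M 3 ε) / 3) + L₄ / (8 * (d * (d + 2))) * (4 * (M 2 ε - κ ε * M 3 ε)))) / ε ^ d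
    with hR
  have hRO : R =O[𝓝[>] 0] fun ε : ℝ => ε ^ m := by
    have h1 : (fun ε => (1 + |k' ε|) * u 0 ε) =O[𝓝[>] 0] fun _ => (1 : ℝ) :=
      ((hκ'.tendsto.abs.const_add 1).mul (hM 0).tendsto).isBigO_one ℝ
    have h2 : (fun ε => K * ε ^ m * ((1 + |k' ε|) * u 0 ε)) =O[𝓝[>] 0]
        fun ε : ℝ => ε ^ m * 1 := ((isBigO_refl (fun ε : ℝ => ε ^ m) _).const_mul_left K).mul h1
    simp only [mul_one] at h2
    refine IsBigO.trans (IsBigO.of_bound 1 ?_) h2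
    filter_upwards [hN, hκk, hpos] with ε h hk hε
    rw [one_mul, Real.norm_eq_abs, Real.norm_eq_abs]
    refine le_trans ?_ (le_abs_self _)
    rw [hR, abs_div, abs_of_pos (pow_pos hε d), div_le_iff₀ (pow_pos hε d)]
    refine h.trans (le_of_eq ?_)
    rw [← hk, abs_mul, abs_of_pos (pow_pos hε 2), hMu 0 ε hε]
    ring
  have hDinv : (fun ε => (u 0 ε - k' ε * u 1 ε)⁻¹) =O[𝓝[>] 0] fun _ => (1 : ℝ) :=
    (hD.inv hD₀pos.ne').isBigO_one
  have t1 : (fun ε => R ε * (u 0 ε - k' ε * u 1 ε)⁻¹) =O[𝓝[>] 0] fun ε : ℝ => ε ^ m := by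
    simpa only [mul_one] using hRO.mul hDinv
  have t2 : (fun ε => L₂ / d * (ε ^ 6 * (k' ε * (u 0 ε - k' ε * u 1 ε)⁻¹))) =O[𝓝[>] 0]
      fun ε : ℝ => ε ^ m := by
    have := (isBigO_pow_of_le hm).mul (hκ'.isBigO_one.mul hDinv)
    simp only [mul_one] at this
    exact this.const_mul_left _
  have t3 : (fun ε => γ * (ε ^ 4 * ((u 2 ε - k' ε * u 3 ε) / (u 0 ε - k' ε * u 1 ε) - P₀ / D₀)))
      =O[𝓝[>] 0] fun ε : ℝ => ε ^ m := by
    have := (isBigO_refl (fun ε : ℝ => ε ^ 4) (𝓝[>] 0)).mul (hP.div hD hD₀pos.ne')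
    simp only [← pow_add] at this
    exact (this.trans (isBigO_pow_of_le hm)).const_mul_left _
  -- The three errors are the numerator remainder, the regularization, and the relative `O(ε ^ 2)`
  -- correction to the `ε ^ 4` coefficient.
  refine ((t1.add t2).add t3).congr' ?_ EventuallyEq.rfl
  filter_upwards [hDM, hPM, hQM, hDne, hpos] with ε hDε hPε hQε hne hε
  have hγP : γ * (P₀ / D₀) = -(L₄ / (8 * (d + 4) * (d + 6))) -
      (d + 2) / (24 * (d + 4) * (d + 6)) * L₂ := by
    rw [hγ, hP₀', hD₀']
    field_simp
    ring
  have hεd : ε ^ d ≠ 0 := by positivity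
  rw [← hγP]
  have hNR : N ε = ε ^ d * (R ε + L₂ / d * (ε ^ 6 * k' ε) +
      γ * (ε ^ 4 * (u 2 ε - k' ε * u 3 ε))) := by
    simp only [hR, hPε, hQε, hγ]
    field_simp
    ring
  rw [hNR, hDε, mul_div_mul_left _ _ hεd]
  simp only [div_eq_mul_inv]
  ring

/-! ### Asymptotics of the height moments -/

theorem heightMoment_eq {d : ℕ} (x : Sph d) (k : ℕ) (ε : ℝ) :
    heightMoment x k ε = (∫ y in nbhd (incl d) ε x,
      ‖(y : EuclideanSpace ℝ (Fin (d + 1))) - x‖ ^ (2 * k) ∂uniformSph d) / 2 ^ k := by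
  rw [heightMoment, ← integral_div]
  congr with y
  rw [pow_mul, dist_sq_sph, mul_pow]
  field_simp

theorem near_heightMoment {d : ℕ} (hd : 0 < d) (x : Sph d) (k : ℕ) :
    Near (fun ε => heightMoment x k ε / ε ^ (d + 2 * k)) (heightCoeff (capConst x) d k) := by
  obtain ⟨K, hK0, hK⟩ := exists_abs_moment_sub_le hd x
  refine IsBigO.of_bound K ?_
  filter_upwards [Ioo_mem_nhdsGT (zero_lt_one (α := ℝ))] with ε hε
  have h := hK (2 * k) ε hε.1 hε.2.le
  have hε0 := hε.1
  rw [Real.norm_eq_abs, Real.norm_of_nonneg (by positivity), heightMoment_eq, heightCoeff]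
  set I := ∫ y in nbhd (incl d) ε x,
      ‖(y : EuclideanSpace ℝ (Fin (d + 1))) - x‖ ^ (2 * k) ∂uniformSph d
  have hd' : (0 : ℝ) < d := by exact_mod_cast hd
  have e : I / 2 ^ k / ε ^ (d + 2 * k) - capConst x * d / ((d + 2 * k) * 2 ^ k) =
      (I - capConst x * d / (d + (2 * k : ℕ)) * ε ^ (d + 2 * k)) / (2 ^ k * ε ^ (d + 2 * k)) := by
    push_cast
    field_simp
  rw [e, abs_div, abs_of_pos (by positivity : 0 < 2 ^ k * ε ^ (d + 2 * k)),
    div_le_iff₀ (by positivity)]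
  have h2 : (1 : ℝ) ≤ 2 ^ k := one_le_pow₀ (by norm_num)
  calc _ ≤ K * ε ^ (d + 2 * k + 2) := h
    _ ≤ K * ε ^ (d + 2 * k + 2) * 2 ^ k := le_mul_of_one_le_right (by positivity) h2
    _ = _ := by ring

/-! ### The weight of the operator -/

/-- The function of `⟨x, y⟩` that equals `1 - κ (1 - ⟨x, y⟩)` on the cap of radius `ε`. -/
def capWeight (ε κ : ℝ) (t : ℝ) : ℝ := if 1 - ε ^ 2 / 2 < t then 1 - κ * (1 - t) else 0

theorem isWeight_capWeight {ε κ : ℝ} (hε : 0 < ε) (hε1 : ε ≤ 1) : IsWeight (capWeight ε κ) where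
  measurable := Measurable.ite measurableSet_Ioi (by fun_prop) measurable_const
  eq_zero t ht := if_neg (by nlinarith)
  bounded := by
    refine ⟨1 + |κ|, fun t ht => ?_⟩
    unfold capWeight
    split_ifs with h
    · have h1 : |1 - t| ≤ 1 := by rw [abs_le]; constructor <;> nlinarith
      calc |1 - κ * (1 - t)| ≤ |1| + |κ * (1 - t)| := abs_sub _ _
        _ ≤ 1 + |κ| * 1 := by rw [abs_one, abs_mul]; gcongr
        _ = _ := by ring
    · rw [abs_zero]; positivity

theorem integral_capWeight {d : ℕ} (x : Sph d) {ε : ℝ} (hε : 0 < ε) (κ : ℝ) (G : Sph d → ℝ) :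
    ∫ y, G y * capWeight ε κ (inner ℝ (x : EuclideanSpace ℝ (Fin (d + 1))) y) ∂uniformSph d =
      ∫ y in nbhd (incl d) ε x,
        G y * (1 - κ * (1 - inner ℝ (x : EuclideanSpace ℝ (Fin (d + 1))) y)) ∂uniformSph d := by
  rw [← integral_indicator (measurableSet_nbhd x ε)]
  congr with y
  by_cases h : y ∈ nbhd (incl d) ε x
  · rw [indicator_of_mem h, capWeight, if_pos ((mem_nbhd_iff hε).1 h)]
  · rw [indicator_of_notMem h, capWeight, if_neg (fun h' => h ((mem_nbhd_iff hε).2 h')), mul_zero]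

/-- The weight may change sign, so errors are estimated in absolute value. With `κ` of order
`ε^(-2)` the factor `1 + |κ| ε ^ 2` stays bounded, and no order is lost. -/
theorem abs_avg_capWeight_le {d : ℕ} (x : Sph d) (b : OrthonormalBasis (Fin d) ℝ (Tan x))
    {ε : ℝ} (hε : 0 < ε) (κ : ℝ) {G : EuclideanSpace ℝ (Fin d) → ℝ} {C : ℝ} (hC : 0 ≤ C)
    (hG : ∀ y ∈ nbhd (incl d) ε x, |G (logCoord x b y)| ≤ C) :
    |avg x b (capWeight ε κ) G| ≤ C * ((1 + |κ| * ε ^ 2) * heightMoment x 0 ε) := by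
  have h0 : heightMoment x 0 ε = (uniformSph d).real (nbhd (incl d) ε x) := by
    simp [heightMoment]
  rw [avg, integral_capWeight x hε κ fun y => G (logCoord x b y), h0, ← mul_assoc,
    ← Real.norm_eq_abs]
  refine norm_setIntegral_le_of_norm_le_const (measure_lt_top _ _) fun y hy => ?_
  have h1 := (mem_nbhd_iff hε).1 hy
  have h2 := (abs_le.1 (abs_inner_sph_le x y)).2
  rw [norm_mul, Real.norm_eq_abs, Real.norm_eq_abs]
  refine mul_le_mul (hG y hy) ?_ (abs_nonneg _) hC
  have h3 : |1 - inner ℝ (x : EuclideanSpace ℝ (Fin (d + 1))) (y : EuclideanSpace ℝ (Fin (d + 1)))|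
      ≤ ε ^ 2 := by
    rw [abs_of_nonneg (by linarith)]
    nlinarith [sq_nonneg ε]
  calc _ ≤ |1| + |κ * (1 - inner ℝ (x : EuclideanSpace ℝ (Fin (d + 1))) y)| := abs_sub _ _
    _ ≤ 1 + |κ| * ε ^ 2 := by rw [abs_one, abs_mul]; gcongr

/-- On the cap `1 - cos ‖v‖` is the height, and the linear weight raises the exponent by one in its
second term. -/
theorem avg_one_sub_cos_pow {d : ℕ} (x : Sph d) (b : OrthonormalBasis (Fin d) ℝ (Tan x))
    {ε : ℝ} (hε : 0 < ε) (hε1 : ε ≤ 1) (κ : ℝ) (k : ℕ) :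
    avg x b (capWeight ε κ) (fun v => (1 - Real.cos ‖v‖) ^ k) =
      heightMoment x k ε - κ * heightMoment x (k + 1) ε := by
  rw [avg, integral_capWeight x hε κ fun y => (1 - Real.cos ‖logCoord x b y‖) ^ k, heightMoment,
    heightMoment, ← integral_const_mul, ← integral_sub]
  · refine setIntegral_congr_fun (measurableSet_nbhd x ε) fun y hy => ?_
    have h1 := (mem_nbhd_iff hε).1 hy
    have h2 := abs_le.1 (abs_inner_sph_le x y)
    rw [norm_logCoord x b (by nlinarith), Real.cos_arccos h2.1 h2.2]
    ring
  · exact (integrable_of_continuous (by fun_prop)).integrableOn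
  · exact (integrable_of_continuous (by fun_prop)).integrableOn

/-- The arc-chord expansions rewritten with `τ ^ 2 = 2 s`, where `s = 1 - cos ‖v‖`, so that their
averages are height moments. -/
theorem logCoord_chord_bounds {d : ℕ} (x : Sph d) (b : OrthonormalBasis (Fin d) ℝ (Tan x))
    {ε : ℝ} (hε : 0 < ε) (hε1 : ε ≤ 1 / 2) {y : Sph d} (hy : y ∈ nbhd (incl d) ε x) :
    ‖logCoord x b y‖ ≤ 2 * ε ∧
    |‖logCoord x b y‖ ^ 2 - (2 * (1 - Real.cos ‖logCoord x b y‖) ^ 1 +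
      3⁻¹ * (1 - Real.cos ‖logCoord x b y‖) ^ 2)| ≤ 1000 * ε ^ 6 ∧
    |‖logCoord x b y‖ ^ 4 - 4 * (1 - Real.cos ‖logCoord x b y‖) ^ 2| ≤ 1000 * ε ^ 6 := by
  have h1 := (mem_nbhd_iff hε).1 hy
  have h2 := abs_le.1 (abs_inner_sph_le x y)
  have hτ := mem_nbhd_iff_norm.1 hy
  obtain ⟨e1, e2, e3⟩ := arccos_chord_bounds x y (hτ.le.trans hε1)
  have hsq := dist_sq_sph x y
  rw [norm_logCoord x b (by nlinarith), Real.cos_arccos h2.1 h2.2]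
  set τ := ‖(y : EuclideanSpace ℝ (Fin (d + 1))) - x‖
  have hτ0 : 0 ≤ τ := norm_nonneg _
  set s := 1 - inner ℝ (x : EuclideanSpace ℝ (Fin (d + 1))) (y : EuclideanSpace ℝ (Fin (d + 1)))
  have h4 : τ ^ 4 = 4 * s ^ 2 := by
    have : τ ^ 4 = (τ ^ 2) ^ 2 := by ring
    rw [this, hsq]; ring
  have h6 : 1000 * τ ^ 6 ≤ 1000 * ε ^ 6 := by gcongr
  refine ⟨by linarith, ?_, ?_⟩
  · have : 2 * s ^ 1 + 3⁻¹ * s ^ 2 = τ ^ 2 + τ ^ 4 / 12 := by rw [h4, hsq]; ring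
    rw [this]
    exact e2.trans h6
  · rw [← h4]
    exact e3.trans h6

theorem abs_avg_norm_sq_sub_le {d : ℕ} (x : Sph d) (b : OrthonormalBasis (Fin d) ℝ (Tan x))
    {ε : ℝ} (hε : 0 < ε) (hε1 : ε ≤ 1 / 2) (κ : ℝ) :
    |avg x b (capWeight ε κ) (fun v => ‖v‖ ^ 2) -
      (2 * (heightMoment x 1 ε - κ * heightMoment x 2 ε) +
        (heightMoment x 2 ε - κ * heightMoment x 3 ε) / 3)|
      ≤ 1000 * ε ^ 6 * ((1 + |κ| * ε ^ 2) * heightMoment x 0 ε) := by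
  have hε2 : ε ≤ 1 := by linarith
  have hw := isWeight_capWeight (κ := κ) hε hε2
  have hb := abs_avg_capWeight_le x b hε κ (C := 1000 * ε ^ 6)
    (G := fun v => ‖v‖ ^ 2 - (2 * (1 - Real.cos ‖v‖) ^ 1 + 3⁻¹ * (1 - Real.cos ‖v‖) ^ 2))
    (by positivity) fun y hy => (logCoord_chord_bounds x b hε hε1 hy).2.1
  have h : avg x b (capWeight ε κ) (fun v => ‖v‖ ^ 2 - (2 * (1 - Real.cos ‖v‖) ^ 1 +
      3⁻¹ * (1 - Real.cos ‖v‖) ^ 2)) = avg x b (capWeight ε κ) (fun v => ‖v‖ ^ 2) -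
      (2 * (heightMoment x 1 ε - κ * heightMoment x 2 ε) +
        (heightMoment x 2 ε - κ * heightMoment x 3 ε) / 3) := by
    rw [avg_sub x b hw (by fun_prop) (by fun_prop), avg_add x b hw (by fun_prop) (by fun_prop),
      avg_const_mul, avg_const_mul, avg_one_sub_cos_pow x b hε hε2, avg_one_sub_cos_pow x b hε hε2]
    ring
  rw [← h]
  exact hb

theorem abs_avg_norm_pow_four_sub_le {d : ℕ} (x : Sph d) (b : OrthonormalBasis (Fin d) ℝ (Tan x))
    {ε : ℝ} (hε : 0 < ε) (hε1 : ε ≤ 1 / 2) (κ : ℝ) :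
    |avg x b (capWeight ε κ) (fun v => ‖v‖ ^ 4) -
      4 * (heightMoment x 2 ε - κ * heightMoment x 3 ε)|
      ≤ 1000 * ε ^ 6 * ((1 + |κ| * ε ^ 2) * heightMoment x 0 ε) := by
  have hε2 : ε ≤ 1 := by linarith
  have hw := isWeight_capWeight (κ := κ) hε hε2
  have hb := abs_avg_capWeight_le x b hε κ (C := 1000 * ε ^ 6)
    (G := fun v => ‖v‖ ^ 4 - 4 * (1 - Real.cos ‖v‖) ^ 2)
    (by positivity) fun y hy => (logCoord_chord_bounds x b hε hε1 hy).2.2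
  have h : avg x b (capWeight ε κ) (fun v => ‖v‖ ^ 4 - 4 * (1 - Real.cos ‖v‖) ^ 2) =
      avg x b (capWeight ε κ) (fun v => ‖v‖ ^ 4) -
      4 * (heightMoment x 2 ε - κ * heightMoment x 3 ε) := by
    rw [avg_sub x b hw (by fun_prop) (by fun_prop), avg_const_mul, avg_one_sub_cos_pow x b hε hε2]
  rw [← h]
  exact hb

/-! ### The averaged Taylor expansion -/

theorem continuous_diag {d k : ℕ}
    (D : ContinuousMultilinearMap ℝ (fun _ : Fin k => EuclideanSpace ℝ (Fin d)) ℝ) :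
    Continuous fun v => D fun _ => v :=
  D.cont.comp (continuous_pi fun _ => continuous_id)

theorem avg_diag_odd {d k : ℕ} (x : Sph d) (b : OrthonormalBasis (Fin d) ℝ (Tan x)) (w : ℝ → ℝ)
    (hk : Odd k) (D : ContinuousMultilinearMap ℝ (fun _ : Fin k => EuclideanSpace ℝ (Fin d)) ℝ) :
    avg x b w (fun v => D fun _ => v) = 0 := by
  refine integral_odd_eq_zero b (G := fun v => D fun _ => v) (fun v => ?_) w
  have := D.map_smul_univ (fun _ => (-1 : ℝ)) fun _ => v
  simpa [hk.neg_one_pow] using this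

/-- Odd orders vanish, so degrees 4 and 5 give the same average; the coefficients are `1 / 2! * 1 /
d` and `1 / 4! * 3 / (d (d + 2))`. -/
theorem avg_taylor {d n : ℕ} (hn : n = 4 ∨ n = 5) (x : Sph d)
    (b : OrthonormalBasis (Fin d) ℝ (Tan x)) {f : Sph d → ℝ}
    (hg : ContDiff ℝ (n + 1) (inNormalCoord x b f)) {w : ℝ → ℝ} (hw : IsWeight w) :
    avg x b w (fun v => ∑ k ∈ Finset.range (n + 1), (k.factorial : ℝ)⁻¹ *
      iteratedFDeriv ℝ k (inNormalCoord x b f) 0 fun _ => v) - avg x b w (fun _ => f x) =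
      (∑ i, d2 x b f i) / (2 * d) * avg x b w (fun v => ‖v‖ ^ 2) +
      (∑ i, ∑ j, d22 x b f i j) / (8 * (d * (d + 2))) * avg x b w (fun v => ‖v‖ ^ 4) := by
  have h4n : (4 : ℕ) ≤ ((n : ℕ∞ω) + 1) := by
    rcases hn with rfl | rfl <;> norm_cast
  have e0 : avg x b w (fun v => iteratedFDeriv ℝ 0 (inNormalCoord x b f) 0 fun _ => v) =
      avg x b w (fun _ => f x) := by
    simp only [iteratedFDeriv_zero_apply, inNormalCoord_zero]
  have e2 := avg_diag_two x b hw (iteratedFDeriv ℝ 2 (inNormalCoord x b f) 0)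
  have e4 := avg_diag_four x b hw (iteratedFDeriv ℝ 4 (inNormalCoord x b f) 0)
    (iteratedFDeriv_four_swap_one_two hg h4n 0) (iteratedFDeriv_four_swap_two_three hg h4n 0)
  have e1 := avg_diag_odd x b w (by decide : Odd 1) (iteratedFDeriv ℝ 1 (inNormalCoord x b f) 0)
  have e3 := avg_diag_odd x b w (by decide : Odd 3) (iteratedFDeriv ℝ 3 (inNormalCoord x b f) 0)
  have e5 := avg_diag_odd x b w (by decide : Odd 5) (iteratedFDeriv ℝ 5 (inNormalCoord x b f) 0)
  rw [avg_sum x b hw _ fun k => (continuous_diag _).const_mul _]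
  simp only [avg_const_mul]
  change _ = (∑ i, d2 x b f i) / d * _ at e2
  change _ = 3 * (∑ i, ∑ j, d22 x b f i j) / (d * (d + 2)) * _ at e4
  rcases hn with rfl | rfl
  · simp only [Finset.sum_range_succ, Finset.sum_range_zero, e0, e1, e2, e3, e4, Nat.factorial]
    push_cast
    generalize (d : ℝ) * (d + 2) = q
    ring
  · simp only [Finset.sum_range_succ, Finset.sum_range_zero, e0, e1, e2, e3, e4, e5, Nat.factorial]
    push_cast
    generalize (d : ℝ) * (d + 2) = q
    ring

theorem exists_abs_numerator_sub_le {d n : ℕ} (hn : n = 4 ∨ n = 5) (x : Sph d)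
    (b : OrthonormalBasis (Fin d) ℝ (Tan x)) {f : Sph d → ℝ}
    (hg : ContDiff ℝ (n + 1) (inNormalCoord x b f)) :
    ∃ K : ℝ, ∀ ε κ : ℝ, 0 < ε → ε ≤ 1 / 2 →
      |∫ y in nbhd (incl d) ε x,
        (f y - f x) * (1 - κ * (1 - inner ℝ (x : EuclideanSpace ℝ (Fin (d + 1))) y)) ∂uniformSph d -
        ((∑ i, d2 x b f i) / (2 * d) * (2 * (heightMoment x 1 ε - κ * heightMoment x 2 ε) +
          (heightMoment x 2 ε - κ * heightMoment x 3 ε) / 3) +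
        (∑ i, ∑ j, d22 x b f i j) / (8 * (d * (d + 2))) *
          (4 * (heightMoment x 2 ε - κ * heightMoment x 3 ε)))|
        ≤ K * ε ^ (n + 1) * ((1 + |κ| * ε ^ 2) * heightMoment x 0 ε) := by
  obtain ⟨K, hK0, hK⟩ := exists_abs_sub_taylor_le hg
  set a₂ := (∑ i, d2 x b f i) / (2 * d)
  set a₄ := (∑ i, ∑ j, d22 x b f i j) / (8 * (d * (d + 2)))
  -- The Taylor remainder, with normal coordinates of norm at most `2 ε`, plus the two arc-chord
  -- errors. The constant does not depend on `κ`, which may then vary with `ε`.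
  refine ⟨K * 2 ^ (n + 1) + |a₂| * 1000 + |a₄| * 1000, fun ε κ hε hε1 => ?_⟩
  have hε2 : ε ≤ 1 := by linarith
  have hw := isWeight_capWeight (κ := κ) hε hε2
  set g := inNormalCoord x b f with hgdef
  have hcont : Continuous g := hg.continuous
  set P : EuclideanSpace ℝ (Fin d) → ℝ := fun v => ∑ k ∈ Finset.range (n + 1),
    (k.factorial : ℝ)⁻¹ * iteratedFDeriv ℝ k g 0 fun _ => v with hP
  have hPcont : Continuous P :=
    continuous_finsetSum _ fun k _ => (continuous_diag _).const_mul _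
  have hI : ∫ y in nbhd (incl d) ε x, (f y - f x) *
      (1 - κ * (1 - inner ℝ (x : EuclideanSpace ℝ (Fin (d + 1))) y)) ∂uniformSph d =
      avg x b (capWeight ε κ) g - avg x b (capWeight ε κ) (fun _ => f x) := by
    rw [← avg_sub x b hw hcont continuous_const, avg,
      integral_capWeight x hε κ fun y => g (logCoord x b y) - f x]
    refine setIntegral_congr_fun (measurableSet_nbhd x ε) fun y hy => ?_
    have h1 := (mem_nbhd_iff hε).1 hy
    rw [hgdef, inNormalCoord_logCoord x b f (by nlinarith)]
  have hT := avg_taylor hn x b hg hw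
  have hR : |avg x b (capWeight ε κ) g - avg x b (capWeight ε κ) P| ≤
      K * 2 ^ (n + 1) * ε ^ (n + 1) * ((1 + |κ| * ε ^ 2) * heightMoment x 0 ε) := by
    rw [← avg_sub x b hw hcont hPcont]
    refine abs_avg_capWeight_le x b hε κ (by positivity) fun y hy => ?_
    have h1 := (logCoord_chord_bounds x b hε hε1 hy).1
    refine (hK _ (by linarith)).trans ?_
    calc K * ‖logCoord x b y‖ ^ (n + 1) ≤ K * (2 * ε) ^ (n + 1) := by gcongr
      _ = _ := by ring
  have hA2 := abs_avg_norm_sq_sub_le x b hε hε1 κ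
  have hA4 := abs_avg_norm_pow_four_sub_le x b hε hε1 κ
  set W := (1 + |κ| * ε ^ 2) * heightMoment x 0 ε with hW
  have hW0 : 0 ≤ W := by
    have : 0 ≤ heightMoment x 0 ε := by simp [heightMoment]
    positivity
  set X₂ := 2 * (heightMoment x 1 ε - κ * heightMoment x 2 ε) +
          (heightMoment x 2 ε - κ * heightMoment x 3 ε) / 3
  set X₄ := 4 * (heightMoment x 2 ε - κ * heightMoment x 3 ε)
  have h6 : ε ^ 6 ≤ ε ^ (n + 1) :=
    pow_le_pow_of_le_one hε.le hε2 (by rcases hn with rfl | rfl <;> norm_num)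
  rw [hI]
  have e : avg x b (capWeight ε κ) g - avg x b (capWeight ε κ) (fun _ => f x) -
      (a₂ * X₂ + a₄ * X₄) = (avg x b (capWeight ε κ) g - avg x b (capWeight ε κ) P) +
      a₂ * (avg x b (capWeight ε κ) (fun v => ‖v‖ ^ 2) - X₂) +
      a₄ * (avg x b (capWeight ε κ) (fun v => ‖v‖ ^ 4) - X₄) := by
    linear_combination hT
  rw [e]
  refine (abs_add_three _ _ _).trans ?_
  rw [abs_mul, abs_mul]
  calc _ ≤ K * 2 ^ (n + 1) * ε ^ (n + 1) * W + |a₂| * (1000 * ε ^ 6 * W) +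
        |a₄| * (1000 * ε ^ 6 * W) := by gcongr
    _ ≤ K * 2 ^ (n + 1) * ε ^ (n + 1) * W + |a₂| * (1000 * ε ^ (n + 1) * W) +
        |a₄| * (1000 * ε ^ (n + 1) * W) := by gcongr
    _ = _ := by ring

/-- The expansion of the operator at a point of `S^d`. -/
theorem sphere_expansion {m d : ℕ} (hm : m = 5 ∨ m = 6) (hd : 1 ≤ d) {f : Sph d → ℝ}
    (hf : ContMDiff (𝓡 d) 𝓘(ℝ, ℝ) m f) (x : Sph d) (b : OrthonormalBasis (Fin d) ℝ (Tan x)) :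
    (∀ᶠ ε in 𝓝[>] (0 : ℝ), A d 8 (incl d) (uniformSph d) ε (fun _ => 1) x ≠ 0) ∧
      (fun ε : ℝ => Q d 8 (incl d) (uniformSph d) ε f x - f x - fourthOrderOp x b f * ε ^ 4)
        =O[𝓝[>] 0] (fun ε : ℝ => ε ^ m) := by
  -- The Taylor polynomial has degree `m - 1`, so that its remainder is of order `ε ^ m`.
  obtain ⟨n, rfl, hn⟩ : ∃ n, m = n + 1 ∧ (n = 4 ∨ n = 5) := by
    rcases hm with rfl | rfl
    · exact ⟨4, rfl, Or.inl rfl⟩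
    · exact ⟨5, rfl, Or.inr rfl⟩
  have hg : ContDiff ℝ (n + 1) (inNormalCoord x b f) := by
    have := contDiff_inNormalCoord x b hf
    exact_mod_cast this
  obtain ⟨K, hK⟩ := exists_abs_numerator_sub_le hn x b hg
  set κ : ℝ → ℝ := fun ε => heightMoment x 1 ε / (heightMoment x 2 ε + ε ^ (d + 8)) with hκ
  set N : ℝ → ℝ := fun ε => ∫ y in nbhd (incl d) ε x, (f y - f x) *
    (1 - κ ε * (1 - inner ℝ (x : EuclideanSpace ℝ (Fin (d + 1))) y)) ∂uniformSph d with hNdef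
  have hhalf : ∀ᶠ ε : ℝ in 𝓝[>] 0, 0 < ε ∧ ε < 1 / 2 := Ioo_mem_nhdsGT (by norm_num)
  obtain ⟨h1, h2⟩ := quotient_asymptotics (m := n + 1) (M := heightMoment x) (κ := κ) (N := N)
    (by omega) (by omega) (capConst_pos x) (near_heightMoment hd x) (Eventually.of_forall fun ε => rfl)
    (∑ i, d2 x b f i) (∑ i, ∑ j, d22 x b f i j) K
    (by filter_upwards [hhalf] with ε hε using hK ε (κ ε) hε.1 hε.2.le)
  -- The eigenvalue along `x` must be nonzero, since the pseudo-inverse discards the kernel.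
  have hM2 : ∀ᶠ ε in 𝓝[>] (0 : ℝ), heightMoment x 2 ε ≠ 0 := by
    have hc : heightCoeff (capConst x) d 2 ≠ 0 := by
      have := capConst_pos x
      have : (0 : ℝ) < d := by exact_mod_cast hd
      unfold heightCoeff
      positivity
    filter_upwards [(near_heightMoment hd x 2).tendsto.eventually_ne hc] with ε hε h0
    exact hε (by rw [h0, zero_div])
  have hA : ∀ ε : ℝ, heightMoment x 2 ε ≠ 0 → ∀ h : Sph d → ℝ,
      A d 8 (incl d) (uniformSph d) ε h x = ∫ y in nbhd (incl d) ε x, h y *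
        (1 - κ ε * (1 - inner ℝ (x : EuclideanSpace ℝ (Fin (d + 1))) y)) ∂uniformSph d := by
    intro ε hε h
    rw [A_sph x hε, hκ]
    have : ε ^ ((d : ℝ) + 8) = ε ^ (d + 8) := by
      rw [← Real.rpow_natCast]; push_cast; rfl
    simp only [this]
  have hA1 : ∀ ε : ℝ, heightMoment x 2 ε ≠ 0 → A d 8 (incl d) (uniformSph d) ε (fun _ => 1) x =
      heightMoment x 0 ε - κ ε * heightMoment x 1 ε := by
    intro ε hε
    rw [hA ε hε, heightMoment, heightMoment, ← integral_const_mul, ← integral_sub]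
    · congr with y; ring
    · exact (integrable_of_continuous (by fun_prop)).integrableOn
    · exact (integrable_of_continuous (by fun_prop)).integrableOn
  have hfc : Continuous f := hf.continuous
  have hAN : ∀ ε : ℝ, heightMoment x 2 ε ≠ 0 → N ε = A d 8 (incl d) (uniformSph d) ε f x -
      f x * A d 8 (incl d) (uniformSph d) ε (fun _ => 1) x := by
    intro ε hε
    rw [hA ε hε, hA ε hε, hNdef, ← integral_const_mul, ← integral_sub]
    · refine integral_congr_ae (Eventually.of_forall fun y => ?_)
      simp only
      ring
    · exact (integrable_of_continuous (by fun_prop)).integrableOn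
    · exact (integrable_of_continuous (by fun_prop)).integrableOn
  refine ⟨?_, h2.congr' ?_ EventuallyEq.rfl⟩
  · filter_upwards [h1, hM2] with ε h hε
    rw [hA1 ε hε]
    exact h
  · filter_upwards [h1, hM2] with ε h hε
    rw [hAN ε hε, Q]
    rw [← hA1 ε hε] at h ⊢
    have hop : fourthOrderOp x b f = -((∑ i, ∑ j, d22 x b f i j) / (8 * (d + 4) * (d + 6))) -
        (d + 2) / (24 * (d + 4) * (d + 6)) * ∑ i, d2 x b f i := by
      have hs : ∑ i, ∑ j, d22 x b f i j = ∑ i, d22 x b f i i +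
          ∑ i, ∑ j ∈ Finset.univ.filter (fun j => j ≠ i), d22 x b f i j := by
        rw [← Finset.sum_add_distrib]
        refine Finset.sum_congr rfl fun i _ => ?_
        rw [Finset.filter_ne', Finset.add_sum_erase _ _ (Finset.mem_univ i)]
      rw [hs, fourthOrderOp]
      have e3 : (d : ℝ) + 1 + 3 = d + 4 := by ring
      have e5 : (d : ℝ) + 1 + 5 = d + 6 := by ring
      have e1 : (d : ℝ) + 1 + 1 = d + 2 := by ring
      simp only [e3, e5, e1]
      ring
    rw [hop, sub_div, mul_div_assoc, div_self h, mul_one]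

/-! ### The circle -/

/-- The unit tangent vector of the circle at `circlePt t`. -/
def circleTangent (t : ℝ) : Tan (circlePt t) :=
  ⟨!₂[-Real.sin t, Real.cos t], by
    rw [Submodule.mem_orthogonal_singleton_iff_inner_right]
    simp [circlePt, PiLp.inner_apply, Fin.sum_univ_two]
    ring⟩

theorem norm_circleTangent (t : ℝ) : ‖circleTangent t‖ = 1 := by
  rw [Submodule.coe_norm]
  simp [circleTangent, EuclideanSpace.norm_eq, Fin.sum_univ_two]

theorem exists_circle_basis (t : ℝ) :
    ∃ b : OrthonormalBasis (Fin 1) ℝ (Tan (circlePt t)), ∀ i, b i = circleTangent t := by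
  have hon : Orthonormal ℝ fun _ : Fin 1 => circleTangent t :=
    ⟨fun _ => norm_circleTangent t, fun i j h => absurd (Subsingleton.elim i j) h⟩
  have hfin : Module.finrank ℝ (Tan (circlePt t)) = 1 := by
    have : Fact (Module.finrank ℝ (EuclideanSpace ℝ (Fin (1 + 1))) = 1 + 1) := ⟨by simp⟩
    refine Submodule.finrank_orthogonal_span_singleton (n := 1) ?_
    intro h
    have := norm_eq_of_mem_sphere (circlePt t)
    rw [h, norm_zero] at this
    exact zero_ne_one this
  refine ⟨(basisOfOrthonormalOfCardEqFinrank hon (by simp [hfin])).toOrthonormalBasis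
    (by rwa [coe_basisOfOrthonormalOfCardEqFinrank]), ?_⟩
  simp

/-- By the addition formulas, the geodesic from `circlePt t` along `circleTangent t` is the angle
parametrization, so normal coordinates are arc length. -/
theorem inNormalCoord_circle {t : ℝ} {b : OrthonormalBasis (Fin 1) ℝ (Tan (circlePt t))}
    (hb : ∀ i, b i = circleTangent t) (f : Sph 1 → ℝ) (s : ℝ) :
    inNormalCoord (circlePt t) b f (s • EuclideanSpace.single 0 1) = f (circlePt (t + s)) := by
  rw [inNormalCoord]
  congr 1
  apply Subtype.ext
  have h : ∑ i, (s • EuclideanSpace.single (0 : Fin 1) (1 : ℝ)) i • b i = s • circleTangent t := by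
    simp [hb]
  have hs : Real.sinc |s| * s = Real.sin s := by
    rcases abs_choice s with h | h <;> rw [h]
    · exact sinc_mul_self s
    · rw [Real.sinc_neg]; exact sinc_mul_self s
  simp only [expMap]
  rw [h, norm_smul, norm_circleTangent, mul_one, Real.norm_eq_abs, Submodule.coe_smul, smul_smul, hs,
    Real.cos_abs]
  ext i
  fin_cases i
  · simp [circlePt, circleTangent, Real.cos_add]; ring
  · simp [circlePt, circleTangent, Real.sin_add]; ring

theorem iteratedFDeriv_inNormalCoord_circle {m : ℕ} {f : Sph 1 → ℝ}
    (hf : ContMDiff (𝓡 1) 𝓘(ℝ, ℝ) m f) {t : ℝ}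
    {b : OrthonormalBasis (Fin 1) ℝ (Tan (circlePt t))} (hb : ∀ i, b i = circleTangent t) {k : ℕ}
    (hk : k ≤ m) :
    (iteratedFDeriv ℝ k (inNormalCoord (circlePt t) b f) 0 fun _ => EuclideanSpace.single 0 1) =
      iteratedDeriv k (fun s => f (circlePt s)) t := by
  have h := iteratedDeriv_comp_smul_eq (contDiff_inNormalCoord (circlePt t) b hf)
    (k := k) (by exact_mod_cast hk) (EuclideanSpace.single 0 1) 0
  rw [zero_smul] at h
  rw [← h]
  simp only [inNormalCoord_circle hb]
  rw [iteratedDeriv_comp_const_add k (fun s => f (circlePt s)) t]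
  simp only [add_zero]

/-- For `p = 2` there are no off-diagonal terms, and `1 / (8 * 5 * 7)` and `3 / (24 * 5 * 7)` both
equal `1 / 280`. -/
theorem fourthOrderOp_circle {m : ℕ} (hm : 4 ≤ m) {f : Sph 1 → ℝ}
    (hf : ContMDiff (𝓡 1) 𝓘(ℝ, ℝ) m f) {t : ℝ}
    {b : OrthonormalBasis (Fin 1) ℝ (Tan (circlePt t))} (hb : ∀ i, b i = circleTangent t) :
    fourthOrderOp (circlePt t) b f = -(1 / 280) * (iteratedDeriv 4 (fun s => f (circlePt s)) t
      + iteratedDeriv 2 (fun s => f (circlePt s)) t) := by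
  have h2 : d2 (circlePt t) b f 0 = iteratedDeriv 2 (fun s => f (circlePt s)) t := by
    rw [d2, ← iteratedFDeriv_inNormalCoord_circle hf hb (by omega)]
    congr 1
    ext i : 1
    fin_cases i <;> rfl
  have h4 : d22 (circlePt t) b f 0 0 = iteratedDeriv 4 (fun s => f (circlePt s)) t := by
    rw [d22, ← iteratedFDeriv_inNormalCoord_circle hf hb (by omega)]
    congr 1
    ext i : 1
    fin_cases i <;> rfl
  have he : Finset.univ.filter (fun j : Fin 1 => j ≠ 0) = ∅ := by decide
  simp only [fourthOrderOp, Fin.sum_univ_one, h2, h4, he, Finset.sum_empty]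
  push_cast
  ring

end LLE

end

theorem mainTheorem9 (m : ℕ) (hm : m = 5 ∨ m = 6) :
    (∀ (d : ℕ) (_ : 1 ≤ d) (f : LLE.Sph d → ℝ) (_ : ContMDiff (𝓡 d) 𝓘(ℝ, ℝ) m f)
      (x : LLE.Sph d) (b : OrthonormalBasis (Fin d) ℝ (LLE.Tan x)),
      (∀ᶠ ε in 𝓝[>] (0 : ℝ),
        LLE.A d 8 (LLE.incl d) (LLE.uniformSph d) ε (fun _ => 1) x ≠ 0) ∧
      (fun ε : ℝ => LLE.Q d 8 (LLE.incl d) (LLE.uniformSph d) ε f x - f x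
          - LLE.fourthOrderOp x b f * ε ^ 4) =O[𝓝[>] 0] (fun ε : ℝ => ε ^ m)) ∧
    (∀ (f : LLE.Sph 1 → ℝ) (_ : ContMDiff (𝓡 1) 𝓘(ℝ, ℝ) m f) (t : ℝ),
      (fun ε : ℝ => LLE.Q 1 8 (LLE.incl 1) (LLE.uniformSph 1) ε f (LLE.circlePt t)
          - f (LLE.circlePt t)
          - (-(1 / 280) * (iteratedDeriv 4 (fun s => f (LLE.circlePt s)) t
              + iteratedDeriv 2 (fun s => f (LLE.circlePt s)) t)) * ε ^ 4)
        =O[𝓝[>] 0] (fun ε : ℝ => ε ^ m)) := by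
  refine ⟨fun d hd f hf x b => LLE.sphere_expansion hm hd hf x b, fun f hf t => ?_⟩
  obtain ⟨b, hb⟩ := LLE.exists_circle_basis t
  have h := (LLE.sphere_expansion hm le_rfl hf (LLE.circlePt t) b).2
  rwa [LLE.fourthOrderOp_circle (by omega) hf hb] at h
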